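/- Let $d\in\mathbb{N}$ and let $\mathbb{T}^d=[0,2\pi]^d$ be the $d$-torus (opposite faces identified). For $f\in L_2(\mathbb{T}^d)$ put $c_k(f)=(2\pi)^{-d}\int_{\mathbb{T}^d}f(x)e^{-ik\cdot x}\,dx$, $k\in\mathbb{Z}^d$. Let $P_0=\{0\}$, $P_j=\{\ell\in\mathbb{Z}:2^{j-1}\le|\ell|<2^j\}$ for $j\ge 1$, and for $k\in\mathbb{N}_0^d$ let $\delta_k(f)=\sum_{m\in P_{k_1}\times\dots\times P_{k_d}}c_m(f)e^{im\cdot x}$. For $\alpha\ge 0$ and $\beta\in\mathbb{R}$ with $\alpha+\beta\ge 0$, the space $H^{\alpha,\beta}(\mathbb{T}^d)$ consists of all $f\in L_2(\mathbb{T}^d)$ with $$\sum_{k\in\mathbb{Z}^d}|c_k(f)|^2\Big(\prod_{j=1}^d(1+|k_j|^2)^{\alpha}\Big)(1+|k|_2^2)^{\beta}<\infty,$$ it carries the (equivalent) norm $$\|f\|_{H^{\alpha,\beta}(\mathbb{T}^d)}=\Big(\sum_{k\in\mathbb{N}_0^d}2^{2(\alpha|k|_1+\beta|k|_\infty)}\|\delta_k(f)\|_2^2\Big)^{1/2},$$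 and $H^\gamma(\mathbb{T}^d)=H^{0,\gamma}(\mathbb{T}^d)$ for $\gamma\ge 0$. For $m\in\mathbb{N}$ let $$I_mf(t)=\frac{1}{2m+1}\sum_{\ell=0}^{2m}f(t^m_\ell)\,D_m(t-t^m_\ell),\qquad t^m_\ell=\frac{2\pi\ell}{2m+1},\quad D_m(t)=\sum_{|k|\le m}e^{ikt},$$ let $\eta_0=I_1$, $\eta_j=I_{2^j}-I_{2^{j-1}}$ for $j\ge1$, let $q_k=\eta_{k_1}\otimes\dots\otimes\eta_{k_d}$ for $k\in\mathbb{N}_0^d$, and $Q_\Delta=\sum_{k\in\Delta}q_k$ for finite $\Delta\subset\mathbb{N}_0^d$. Theorem. Let $\alpha>0$, $\gamma\ge0$ and $\beta<\gamma$ be such that $\min\{\alpha,\alpha+\beta\}>\frac12$, and let $0<\varepsilon<\gamma-\beta<\alpha$. For $\xi>0$ put $$\Delta_\varepsilon(\xi)=\{k\in\mathbb{N}_0^d:(\alpha-\varepsilon)|k|_1-(\gamma-\beta-\varepsilon)|k|_\infty\le\xi\}.$$ Then there is a constant $C=C(\alpha,\beta,\gamma,\varepsilon,d)>0$ such that every $f\in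 H^{\alpha,\beta}(\mathbb{T}^d)$ has a continuous representative and, for all such $f$ and all $\xi>0$, the set $\Delta_\varepsilon(\xi)$ is finite, $f-Q_{\Delta_\varepsilon(\xi)}f\in H^\gamma(\mathbb{T}^d)$ and $$\|f-Q_{\Delta_\varepsilon(\xi)}f\|_{H^\gamma(\mathbb{T}^d)}\le C\,2^{-\xi}\,\|f\|_{H^{\alpha,\beta}(\mathbb{T}^d)},$$ where $Q_{\Delta_\varepsilon(\xi)}$ samples the continuous representative of $f$. -/

import Mathlib

open MeasureTheory
open scoped ENNReal Real

noncomputable section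

namespace SparseSampling

/-- The circle `𝕋 = [0, 2π]` with end points identified. -/
abbrev Circ : Type := AddCircle (2 * π)

instance factTwoPi : Fact (0 < 2 * π) := ⟨Real.two_pi_pos⟩

/-- The `d`-dimensional torus `𝕋^d`; its `volume` is the product of the arc length measures
(total mass `(2π)^d`). -/
abbrev Torus (d : ℕ) : Type := Fin d → Circ

/-! ### Fourier coefficients and dyadic blocks -/

/-- The exponential `x ↦ e^{i k·x}`, `k ∈ ℤ^d`, on `𝕋^d`. -/
def expChar {d : ℕ} (k : Fin d → ℤ) (x : Torus d) : ℂ :=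
  ∏ j, fourier (k j) (x j)

/-- The Fourier coefficient `c_k(f) = (2π)^{-d} ∫ f(x) e^{-i k·x} dx`. -/
def fourierCoef {d : ℕ} (f : Torus d → ℂ) (k : Fin d → ℤ) : ℂ :=
  (1 / (2 * (π : ℂ)) ^ d) * ∫ x, f x * expChar (-k) x

/-- `P_0 = {0}` and `P_j = {ℓ ∈ ℤ : 2^{j-1} ≤ |ℓ| < 2^j}` for `j ≥ 1`. -/
def dyadicBlock : ℕ → Finset ℤ
  | 0 => {0}
  | j + 1 => (Finset.Icc (-(2 ^ (j + 1))) (2 ^ (j + 1))).filter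
      (fun l => 2 ^ j ≤ |l| ∧ |l| < 2 ^ (j + 1))

/-- `𝒫_k = P_{k_1} × ⋯ × P_{k_d}`. -/
def dyadicBox {d : ℕ} (k : Fin d → ℕ) : Finset (Fin d → ℤ) :=
  Fintype.piFinset fun j => dyadicBlock (k j)

/-- `δ_k(f) = ∑_{m ∈ 𝒫_k} c_m(f) e^{i m·x}`. -/
def dyadicPart {d : ℕ} (k : Fin d → ℕ) (f : Torus d → ℂ) (x : Torus d) : ℂ :=
  ∑ m ∈ dyadicBox k, fourierCoef f m * expChar m x

/-- `|k|_1` for `k ∈ ℕ_0^d`. -/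
def norm1 {d : ℕ} (k : Fin d → ℕ) : ℕ := ∑ j, k j

/-- `|k|_∞` for `k ∈ ℕ_0^d`. -/
def normInf {d : ℕ} (k : Fin d → ℕ) : ℕ := Finset.univ.sup k

/-! ### Function spaces -/

/-- `f ∈ H^{α,β}(𝕋^d)`: `f ∈ L_2(𝕋^d)` and
`∑_k |c_k(f)|² ∏_j (1 + |k_j|²)^α (1 + |k|_2²)^β < ∞`. -/
def MemHybrid {d : ℕ} (α β : ℝ) (f : Torus d → ℂ) : Prop :=
  MemLp f 2 volume ∧
    Summable fun k : Fin d → ℤ =>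
      ‖fourierCoef f k‖ ^ 2 * (∏ j, (1 + (k j : ℝ) ^ 2) ^ α) * (1 + ∑ j, (k j : ℝ) ^ 2) ^ β

/-- `f ∈ H^γ(𝕋^d)`: `f ∈ L_2(𝕋^d)` and `∑_k |c_k(f)|² (1 + |k|_2²)^γ < ∞`. -/
def MemSobolev {d : ℕ} (γ : ℝ) (f : Torus d → ℂ) : Prop :=
  MemLp f 2 volume ∧
    Summable fun k : Fin d → ℤ => ‖fourierCoef f k‖ ^ 2 * (1 + ∑ j, (k j : ℝ) ^ 2) ^ γ

/-- `‖f‖_{H^{α,β}} = (∑_{k ∈ ℕ_0^d} 2^{2(α|k|_1 + β|k|_∞)} ‖δ_k(f)‖_2²)^{1/2}`,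
as an element of `[0, ∞]`. -/
def hybridNorm {d : ℕ} (α β : ℝ) (f : Torus d → ℂ) : ℝ≥0∞ :=
  (∑' k : Fin d → ℕ,
    ENNReal.ofReal ((2 : ℝ) ^ (2 * (α * (norm1 k : ℝ) + β * (normInf k : ℝ)))) *
      eLpNorm (dyadicPart k f) 2 volume ^ 2) ^ (1 / 2 : ℝ)

/-- `‖f‖_{H^γ} = (∑_{k ∈ ℕ_0^d} 2^{2γ|k|_∞} ‖δ_k(f)‖_2²)^{1/2}`,
as an element of `[0, ∞]`. -/
def sobolevNorm {d : ℕ} (γ : ℝ) (f : Torus d → ℂ) : ℝ≥0∞ :=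
  (∑' k : Fin d → ℕ,
    ENNReal.ofReal ((2 : ℝ) ^ (2 * (γ * (normInf k : ℝ)))) *
      eLpNorm (dyadicPart k f) 2 volume ^ 2) ^ (1 / 2 : ℝ)

/-! ### Sampling operators -/

/-- The Dirichlet kernel `D_m(t) = ∑_{|k| ≤ m} e^{i k t}`. -/
def dirichletKernel (m : ℕ) (t : Circ) : ℂ :=
  ∑ k ∈ Finset.Icc (-(m : ℤ)) (m : ℤ), fourier k t

/-- The node `t^m_ℓ = 2πℓ/(2m+1)`. -/
def node (m l : ℕ) : Circ := ((2 * π * (l : ℝ) / (2 * (m : ℝ) + 1) : ℝ) : AddCircle (2 * π))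

/-- Trigonometric interpolation
`I_m f(t) = (2m+1)^{-1} ∑_{ℓ=0}^{2m} f(t^m_ℓ) D_m(t - t^m_ℓ)`. -/
def interp (m : ℕ) : Module.End ℂ (Circ → ℂ) where
  toFun f t := (1 / (2 * (m : ℂ) + 1)) *
    ∑ l ∈ Finset.range (2 * m + 1), f (node m l) * dirichletKernel m (t - node m l)
  map_add' f g := by
    ext t
    simp [add_mul, Finset.sum_add_distrib, mul_add]
  map_smul' c f := by
    ext t
    simp only [Pi.smul_apply, smul_eq_mul, RingHom.id_apply, mul_assoc, ← Finset.mul_sum]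
    ring

/-- `η_0 = I_1` and `η_j = I_{2^j} - I_{2^{j-1}}` for `j ≥ 1`. -/
def eta : ℕ → Module.End ℂ (Circ → ℂ)
  | 0 => interp 1
  | j + 1 => interp (2 ^ (j + 1)) - interp (2 ^ j)

/-- The operator on functions on `𝕋^d` that applies `A` in the `i`-th variable and leaves the other
variables fixed. -/
def inVariable {d : ℕ} (i : Fin d) (A : Module.End ℂ (Circ → ℂ)) :
    Module.End ℂ (Torus d → ℂ) where
  toFun f x := A (fun t => f (Function.update x i t)) (x i)
  map_add' f g := by
    ext x
    exact congrFun (A.map_add (fun t => f (Function.update x i t))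
      (fun t => g (Function.update x i t))) (x i)
  map_smul' c f := by
    ext x
    exact congrFun (A.map_smul c (fun t => f (Function.update x i t))) (x i)

/-- `q_k = η_{k_1} ⊗ ⋯ ⊗ η_{k_d}`: the composition of the operators `η_{k_i}` acting in the
`i`-th variable, `i = 1, …, d`. -/
def q {d : ℕ} (k : Fin d → ℕ) : Module.End ℂ (Torus d → ℂ) :=
  (List.ofFn fun i => inVariable i (eta (k i))).prod

/-- `Q_Δ = ∑_{k ∈ Δ} q_k` for a finite set `Δ ⊂ ℕ_0^d`. -/
def Q {d : ℕ} (Δ : Finset (Fin d → ℕ)) : Module.End ℂ (Torus d → ℂ) := ∑ k ∈ Δ, q k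

/-- `Δ_ε(ξ) = {k ∈ ℕ_0^d : (α - ε)|k|_1 - (γ - β - ε)|k|_∞ ≤ ξ}`. -/
def indexSet (d : ℕ) (α β γ ε ξ : ℝ) : Set (Fin d → ℕ) :=
  {k | (α - ε) * (norm1 k : ℝ) - (γ - β - ε) * (normInf k : ℝ) ≤ ξ}

end SparseSampling

end

noncomputable section

namespace SparseSampling

/-! ### Dyadic levels and aliasing in one variable -/

/-! Everything is read off Fourier coefficients. Since min(α, α+β) > 1/2, Cauchy-Schwarz makes the
Fourier series of f absolutely convergent. Its sum is the continuous representative, and the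
sampling operators, being built from finitely many point values, act on it term by term. On
exponentials interpolation is aliasing (`interp_fourier`): n becomes its balanced residue modulo the
number of nodes. Hence η_k kills every frequency of level below k, and the q_k with k ≤ `levels n`
add up to the identity on the exponential of frequency n. The error is therefore carried by the k
outside Δ_ε(ξ), and its m-th coefficient is at most ∑_n |c_n| ∑_{k∉Δ} `absCoef k n m`.

The Schur test `tsum_sq_compl_indexSet_le` bounds this, with |n|_1 and |n|_∞ read on the level
vector of n. For fixed n the matrix entries sum to at most 2^d and q_k produces levels at most k_j +
1, so the H^γ weight costs a constant times 2^{2γ|k|_∞}. For fixed m the entries are summable over n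
against 2^{-(1+δ)(|n|_1-|k|_1)}, because a residue class modulo at least 2^k has O(2^r) members of
level at most k+r. Finally ∑_{k∉Δ} 2^{2((γ-β)|k|_∞-α|k|_1)} = O(2^{-2ξ}) (`tsum_compl_indexSet_le`):
ε leaves geometric decay in the non-maximal coordinates, so no power of ξ appears. The gap between
min(α, α+β) and 1/2 pays for the weight in n. -/

/-- The index of the dyadic block that contains `n`. -/
def level (n : ℤ) : ℕ := Nat.size n.natAbs

lemma natAbs_lt_two_pow_iff {n : ℤ} {k : ℕ} : n.natAbs < 2 ^ k ↔ level n ≤ k := Nat.size_le.symm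

lemma mem_dyadicBlock {m : ℤ} {k : ℕ} : m ∈ dyadicBlock k ↔ level m = k := by
  cases k with
  | zero => simp [dyadicBlock, level, Nat.size_eq_zero]
  | succ j =>
    have h1 : level m = j + 1 ↔ m.natAbs < 2 ^ (j + 1) ∧ 2 ^ j ≤ m.natAbs := by
      rw [natAbs_lt_two_pow_iff, ← Nat.lt_size]
      change _ ↔ _ ∧ j < level m
      omega
    have h2 : (2 : ℤ) ^ j = ((2 ^ j : ℕ) : ℤ) := by push_cast; rfl
    have h3 : (2 : ℤ) ^ (j + 1) = ((2 ^ (j + 1) : ℕ) : ℤ) := by push_cast; rfl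
    rw [h1, dyadicBlock, Finset.mem_filter, Finset.mem_Icc, h2, h3, Int.abs_eq_natAbs]
    generalize 2 ^ j = M
    generalize 2 ^ (j + 1) = M'
    omega

/-- The frequency to which interpolation at `2 * 2 ^ k + 1` nodes maps the frequency `n`. -/
def aliasFreq (k : ℕ) (n : ℤ) : ℤ := n.bmod (2 * 2 ^ k + 1)

lemma aliasFreq_eq_self {k : ℕ} {n : ℤ} (h : n.natAbs ≤ 2 ^ k) : aliasFreq k n = n := by
  rw [aliasFreq, Int.bmod_eq_iff (by positivity)]
  generalize 2 ^ k = M at h ⊢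
  push_cast
  refine ⟨by omega, by omega, by simp⟩

lemma natAbs_aliasFreq_le (k : ℕ) (n : ℤ) : (aliasFreq k n).natAbs ≤ 2 ^ k := by
  have h1 := Int.le_bmod (x := n) (m := 2 * 2 ^ k + 1) (by positivity)
  have h2 := Int.bmod_le (x := n) (m := 2 * 2 ^ k + 1) (by positivity)
  rw [aliasFreq]
  generalize n.bmod (2 * 2 ^ k + 1) = b at *
  have h3 : ((2 * 2 ^ k + 1 : ℕ) : ℤ) = 2 * ((2 ^ k : ℕ) : ℤ) + 1 := by push_cast; ring
  rw [h3] at h1 h2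
  generalize 2 ^ k = M at *
  omega

lemma level_aliasFreq_le (k : ℕ) (n : ℤ) : level (aliasFreq k n) ≤ k + 1 := by
  rw [← natAbs_lt_two_pow_iff]
  exact (natAbs_aliasFreq_le k n).trans_lt (Nat.pow_lt_pow_right one_lt_two (Nat.lt_succ_self k))

lemma modEq_of_aliasFreq_eq {k : ℕ} {n m : ℤ} (h : aliasFreq k n = m) :
    n ≡ m [ZMOD ((2 * 2 ^ k + 1 : ℕ) : ℤ)] := by
  rw [← h]
  exact ((Int.modEq_iff_dvd).2 Int.dvd_bmod_sub_self)

lemma sum_root_of_unity {N : ℕ} (hN : 0 < N) (j : ℤ) :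
    ∑ l ∈ Finset.range N, Complex.exp (2 * π * Complex.I * j * l / N) =
      if (N : ℤ) ∣ j then (N : ℂ) else 0 := by
  have hN0 : (N : ℂ) ≠ 0 := by exact_mod_cast hN.ne'
  have h1 : ∀ l ∈ Finset.range N, Complex.exp (2 * π * Complex.I * j * l / N) =
      Complex.exp (2 * π * Complex.I * j / N) ^ l := by
    intro l _
    rw [← Complex.exp_nat_mul]
    congr 1
    ring
  rw [Finset.sum_congr rfl h1]
  have h2 : Complex.exp (2 * π * Complex.I * j / N) = 1 ↔ (N : ℤ) ∣ j := by
    rw [Complex.exp_eq_one_iff]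
    constructor
    · rintro ⟨n, hn⟩
      refine ⟨n, ?_⟩
      have h3 : (2 * π * Complex.I) * j = (2 * π * Complex.I) * (N * n) := by
        field_simp at hn
        linear_combination (2 * π * Complex.I) * hn
      have h4 := mul_left_cancel₀ Complex.two_pi_I_ne_zero h3
      exact_mod_cast h4
    · rintro ⟨n, rfl⟩
      refine ⟨n, ?_⟩
      push_cast
      field_simp
  split_ifs with h
  · rw [h2.2 h]
    simp
  · have h3 : Complex.exp (2 * π * Complex.I * j / N) ≠ 1 := fun h' => h (h2.1 h')
    rw [geom_sum_eq h3, ← Complex.exp_nat_mul]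
    have h4 : Complex.exp (N * (2 * π * Complex.I * j / N)) = 1 := by
      rw [Complex.exp_eq_one_iff]
      exact ⟨j, by field_simp⟩
    rw [h4]
    simp

lemma fourier_node (M l : ℕ) (n : ℤ) :
    fourier n (node M l) = Complex.exp (2 * π * Complex.I * n * l / ((2 * M + 1 : ℕ) : ℂ)) := by
  rw [node, fourier_coe_apply]
  congr 1
  push_cast
  have : (2 * (M : ℂ) + 1) ≠ 0 := by exact_mod_cast (Nat.succ_ne_zero (2 * M))
  have h2 : (π : ℂ) ≠ 0 := by exact_mod_cast Real.pi_ne_zero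
  field_simp

lemma fourier_sub_apply (n : ℤ) (s t : Circ) : fourier n (t - s) = fourier n t * fourier (-n) s := by
  simp [fourier_apply, sub_eq_add_neg, AddCircle.toCircle_add]

/-- Interpolation of an exponential is the aliased exponential. -/
lemma interp_fourier (M : ℕ) (n : ℤ) :
    interp M (fun t => fourier n t) = fun t => fourier (n.bmod (2 * M + 1)) t := by
  ext t
  have hM : (2 * (M : ℂ) + 1) ≠ 0 := by exact_mod_cast (Nat.succ_ne_zero (2 * M))
  have h1 : ∀ l ∈ Finset.range (2 * M + 1),
      fourier n (node M l) * dirichletKernel M (t - node M l) =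
        ∑ k ∈ Finset.Icc (-(M : ℤ)) (M : ℤ), fourier k t *
          Complex.exp (2 * π * Complex.I * (n - k : ℤ) * l / ((2 * M + 1 : ℕ) : ℂ)) := by
    intro l _
    rw [dirichletKernel, Finset.mul_sum]
    refine Finset.sum_congr rfl fun k _ => ?_
    rw [fourier_sub_apply, ← fourier_node, sub_eq_add_neg, fourier_add]
    ring
  change (1 / (2 * (M : ℂ) + 1)) * ∑ l ∈ Finset.range (2 * M + 1), _ = _
  rw [Finset.sum_congr rfl h1, Finset.sum_comm]
  simp_rw [← Finset.mul_sum]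
  -- By discrete orthogonality only k ≡ n modulo 2M+1 survives, and [-M, M] contains exactly one
  -- such k.
  rw [Finset.sum_eq_single (n.bmod (2 * M + 1))]
  · rw [sum_root_of_unity (Nat.succ_pos _), if_pos Int.dvd_self_sub_bmod]
    push_cast
    field_simp
  · intro k hk hne
    rw [sum_root_of_unity (Nat.succ_pos _), if_neg, mul_zero]
    intro hdvd
    apply hne
    rw [eq_comm, Int.bmod_eq_iff (Nat.succ_pos _)]
    rw [Finset.mem_Icc] at hk
    push_cast at hdvd ⊢
    refine ⟨by omega, by omega, ?_⟩
    rw [← dvd_neg, neg_sub]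
    exact hdvd
  · intro hk
    exfalso
    apply hk
    have h1 := Int.le_bmod (x := n) (m := 2 * M + 1) (Nat.succ_pos _)
    have h2 := Int.bmod_le (x := n) (m := 2 * M + 1) (Nat.succ_pos _)
    rw [Finset.mem_Icc]
    push_cast at h1 h2
    omega

/-- The `m`-th Fourier coefficient of `η_k` applied to the exponential of frequency `n`. -/
def etaCoef : ℕ → ℤ → ℤ → ℂ
  | 0, n, m => if aliasFreq 0 n = m then 1 else 0
  | k + 1, n, m => (if aliasFreq (k + 1) n = m then 1 else 0) - (if aliasFreq k n = m then 1 else 0)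

lemma sum_etaCoef (K : ℕ) (n m : ℤ) :
    ∑ k ∈ Finset.range (K + 1), etaCoef k n m = if aliasFreq K n = m then 1 else 0 := by
  induction K with
  | zero => simp [etaCoef]
  | succ K ih => rw [Finset.sum_range_succ, ih, etaCoef]; ring

/-- The sum telescopes to one interpolant, which is exact at n because |n| < 2^(level n). -/
lemma sum_etaCoef_level (n m : ℤ) :
    ∑ k ∈ Finset.range (level n + 1), etaCoef k n m = if n = m then 1 else 0 := by
  rw [sum_etaCoef, aliasFreq_eq_self (natAbs_lt_two_pow_iff.2 le_rfl).le]

/-- Here |n| < 2^(k-1), so both interpolants in η_k reproduce the exponential and their difference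
vanishes. -/
lemma etaCoef_eq_zero {k : ℕ} {n : ℤ} (m : ℤ) (h : level n < k) : etaCoef k n m = 0 := by
  cases k with
  | zero => omega
  | succ j =>
    have h1 : n.natAbs < 2 ^ j := natAbs_lt_two_pow_iff.2 (by omega)
    have h2 : 2 ^ j ≤ 2 ^ (j + 1) := Nat.pow_le_pow_right two_pos (Nat.le_succ j)
    rw [etaCoef, aliasFreq_eq_self h1.le, aliasFreq_eq_self (h1.le.trans h2), sub_self]

lemma level_le_of_etaCoef_ne_zero {k : ℕ} {n m : ℤ} (h : etaCoef k n m ≠ 0) : level m ≤ k + 1 := by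
  contrapose! h
  have h1 : ∀ j ≤ k, aliasFreq j n ≠ m := by
    rintro j hj rfl
    have := level_aliasFreq_le j n
    omega
  cases k with
  | zero => simp [etaCoef, h1 0 le_rfl]
  | succ j => simp [etaCoef, h1 (j + 1) le_rfl, h1 j (Nat.le_succ j)]

/-- Treats k = 0 and k > 0 uniformly: the row and column estimates only need η_k to be dominated by
two aliasing maps, each with at least 2^k nodes. -/
lemma exists_enorm_etaCoef_le (k : ℕ) : ∃ i j : ℕ, 2 ^ k ≤ 2 * 2 ^ i + 1 ∧ 2 ^ k ≤ 2 * 2 ^ j + 1 ∧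
    ∀ n m : ℤ, ‖etaCoef k n m‖ₑ ≤
      (if aliasFreq i n = m then 1 else 0) + (if aliasFreq j n = m then 1 else 0) := by
  have h : ∀ j n m, ‖(if aliasFreq j n = m then 1 else 0 : ℂ)‖ₑ =
      (if aliasFreq j n = m then 1 else 0) := by
    intro j n m; split_ifs <;> simp
  cases k with
  | zero =>
    refine ⟨0, 0, by simp, by simp, fun n m => ?_⟩
    rw [etaCoef, h]
    exact le_self_add
  | succ k =>
    refine ⟨k + 1, k, by omega, by rw [pow_succ]; omega, fun n m => ?_⟩
    rw [etaCoef, ← h, ← h]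
    exact enorm_sub_le

lemma tsum_enorm_etaCoef_le (k : ℕ) (n : ℤ) : ∑' m, ‖etaCoef k n m‖ₑ ≤ 2 := by
  obtain ⟨i, j, -, -, h⟩ := exists_enorm_etaCoef_le k
  refine (ENNReal.tsum_le_tsum (h n)).trans ?_
  rw [ENNReal.tsum_add]
  simp_rw [@eq_comm _ (aliasFreq _ n)]
  rw [tsum_ite_eq, tsum_ite_eq, one_add_one_eq_two]

/-! ### Powers of two, geometric series and counting in residue classes. -/

lemma two_rpow_add (x y : ℝ) : (2 : ℝ≥0∞) ^ (x + y) = 2 ^ x * 2 ^ y :=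
  ENNReal.rpow_add _ _ two_ne_zero ENNReal.ofNat_ne_top

lemma two_rpow_mono {x y : ℝ} (h : x ≤ y) : (2 : ℝ≥0∞) ^ x ≤ 2 ^ y :=
  ENNReal.rpow_le_rpow_of_exponent_le one_le_two h

lemma two_rpow_ne_zero (x : ℝ) : (2 : ℝ≥0∞) ^ x ≠ 0 := by
  simp [ENNReal.rpow_eq_zero_iff]

lemma two_rpow_ne_top (x : ℝ) : (2 : ℝ≥0∞) ^ x ≠ ∞ := by
  simp [ENNReal.rpow_eq_top_iff]

/-- The sum of the geometric series with ratio `2 ^ (-δ)`. -/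
def geomConst (δ : ℝ) : ℝ≥0∞ := (1 - 2 ^ (-δ))⁻¹

lemma geomConst_ne_top {δ : ℝ} (hδ : 0 < δ) : geomConst δ ≠ ∞ := by
  rw [geomConst, Ne, ENNReal.inv_eq_top, tsub_eq_zero_iff_le, not_le]
  exact ENNReal.rpow_lt_one_of_one_lt_of_neg ENNReal.one_lt_two (by linarith)

lemma tsum_two_rpow (δ : ℝ) : ∑' r : ℕ, (2 : ℝ≥0∞) ^ (-δ * r) = geomConst δ := by
  rw [geomConst, ← ENNReal.tsum_geometric]
  simp_rw [ENNReal.rpow_mul, ENNReal.rpow_natCast]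

/-- The half-open interval has length 2·2^(k+r) ≤ 2·2^r·N, hence meets a residue class modulo N at
most 2·2^r times; the factor 3 leaves slack. -/
lemma card_modEq_le {k r N : ℕ} (hN : 2 ^ k ≤ N) (m : ℤ) :
    ((Finset.Ioc (-(2 ^ (k + r) : ℤ)) (2 ^ (k + r))).filter (· ≡ m [ZMOD (N : ℤ)])).card ≤
      3 * 2 ^ r := by
  have hN0 : 0 < N := (Nat.two_pow_pos k).trans_le hN
  have h1 := Int.Ioc_filter_modEq_card (-(2 ^ (k + r) : ℤ)) (2 ^ (k + r)) (r := (N : ℤ))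
    (by exact_mod_cast hN0) m
  have hNq : (0 : ℚ) < N := by exact_mod_cast hN0
  have h2 : ((2 ^ (k + r) : ℤ) - m : ℚ) / N ≤ (-(2 ^ (k + r) : ℤ) - m : ℚ) / N + 2 * 2 ^ r := by
    rw [div_add' _ _ _ hNq.ne', div_le_div_iff_of_pos_right hNq]
    have h3 : (2 : ℚ) ^ k ≤ N := by exact_mod_cast hN
    have h4 : (2 : ℚ) ^ k * 2 ^ r ≤ N * 2 ^ r := by gcongr
    push_cast
    rw [pow_add]
    linarith
  have h3 := Int.floor_mono h2
  have h4 : ⌊(-(2 ^ (k + r) : ℤ) - m : ℚ) / N + 2 * 2 ^ r⌋ =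
      ⌊(-(2 ^ (k + r) : ℤ) - m : ℚ) / N⌋ + 2 * 2 ^ r := by
    exact_mod_cast Int.floor_add_intCast _ (2 * 2 ^ r)
  rw [h4] at h3
  have h5 : (0 : ℤ) < 2 ^ r := by positivity
  push_cast at h1 h3
  zify
  rw [h1]
  refine max_le ?_ (by positivity)
  linarith

/-- Group n by r = level n - k: O(2^r) members of weight 2^(-(1+δ)r) leave 2^(-δr). This count is
what forces the exponent above 1, and so smoothness above 1/2. -/
lemma tsum_modEq_le {δ : ℝ} {k N : ℕ} (hN : 2 ^ k ≤ N) (m : ℤ) :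
    ∑' n : ℤ, (if k ≤ level n then (2 : ℝ≥0∞) ^ (-(1 + δ) * ((level n : ℝ) - k)) else 0) *
      (if n ≡ m [ZMOD (N : ℤ)] then 1 else 0) ≤ 3 * geomConst δ := by
  set F : ℕ → Finset ℤ := fun r => (Finset.Ioc (-(2 ^ (k + r) : ℤ)) (2 ^ (k + r))).filter
    (· ≡ m [ZMOD (N : ℤ)]) with hF
  calc _ ≤ ∑' n : ℤ, ∑' r : ℕ, (if n ∈ F r then (2 : ℝ≥0∞) ^ (-(1 + δ) * r) else 0) := by
        refine ENNReal.tsum_le_tsum fun n => ?_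
        split_ifs with h1 h2
        · obtain ⟨r, hr⟩ := Nat.exists_eq_add_of_le h1
          refine le_trans ?_ (ENNReal.le_tsum r)
          have h3 : n.natAbs < 2 ^ (k + r) := natAbs_lt_two_pow_iff.2 hr.le
          rw [if_pos, hr]
          · simp
          · rw [hF, Finset.mem_filter, Finset.mem_Ioc]
            refine ⟨?_, h2⟩
            have h4 : (2 : ℤ) ^ (k + r) = ((2 ^ (k + r) : ℕ) : ℤ) := by push_cast; rfl
            rw [h4]
            omega
        all_goals simp
    _ = ∑' r : ℕ, ∑' n : ℤ, (if n ∈ F r then (2 : ℝ≥0∞) ^ (-(1 + δ) * r) else 0) :=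
        ENNReal.tsum_comm
    _ ≤ ∑' r : ℕ, 3 * (2 : ℝ≥0∞) ^ (-δ * r) := by
        refine ENNReal.tsum_le_tsum fun r => ?_
        rw [tsum_eq_sum (s := F r) (fun n hn => if_neg hn), Finset.sum_ite_mem, Finset.inter_self,
          Finset.sum_const, nsmul_eq_mul]
        have h1 : ((F r).card : ℝ≥0∞) ≤ ((3 * 2 ^ r : ℕ) : ℝ≥0∞) := by
          exact_mod_cast card_modEq_le hN m
        refine (mul_le_mul_left h1 _).trans ?_
        have h2 : -δ * (r : ℝ) = r + -(1 + δ) * r := by ring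
        rw [h2, two_rpow_add, ENNReal.rpow_natCast]
        push_cast
        rw [mul_assoc]
    _ = 3 * geomConst δ := by rw [ENNReal.tsum_mul_left, tsum_two_rpow]

lemma tsum_alias_le {δ : ℝ} {k i : ℕ} (hi : 2 ^ k ≤ 2 * 2 ^ i + 1) (m : ℤ) :
    ∑' n : ℤ, (if k ≤ level n then (2 : ℝ≥0∞) ^ (-(1 + δ) * ((level n : ℝ) - k)) else 0) *
      (if aliasFreq i n = m then 1 else 0) ≤ 3 * geomConst δ := by
  refine le_trans (ENNReal.tsum_le_tsum fun n => ?_) (tsum_modEq_le hi m)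
  gcongr
  split_ifs with h1 h2
  · exact le_rfl
  · exact absurd (modEq_of_aliasFreq_eq h1) h2
  all_goals simp

/-- The columns of the aliasing matrix of `η_k` are summable against a decaying weight. -/
lemma tsum_level_etaCoef_le (δ : ℝ) (k : ℕ) (m : ℤ) :
    ∑' n : ℤ, (2 : ℝ≥0∞) ^ (-(1 + δ) * ((level n : ℝ) - k)) * ‖etaCoef k n m‖ₑ ≤
      6 * geomConst δ := by
  obtain ⟨i, j, hi, hj, h⟩ := exists_enorm_etaCoef_le k
  calc _ ≤ ∑' n : ℤ, ((if k ≤ level n then (2 : ℝ≥0∞) ^ (-(1 + δ) * ((level n : ℝ) - k)) else 0) *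
      (if aliasFreq i n = m then 1 else 0) +
      (if k ≤ level n then (2 : ℝ≥0∞) ^ (-(1 + δ) * ((level n : ℝ) - k)) else 0) *
      (if aliasFreq j n = m then 1 else 0)) := by
        refine ENNReal.tsum_le_tsum fun n => ?_
        rw [← mul_add]
        by_cases h1 : k ≤ level n
        · rw [if_pos h1]
          gcongr
          exact h n m
        · simp [etaCoef_eq_zero m (not_le.1 h1)]
    _ ≤ 3 * geomConst δ + 3 * geomConst δ := by
        rw [ENNReal.tsum_add]
        exact add_le_add (tsum_alias_le hi m) (tsum_alias_le hj m)
    _ = 6 * geomConst δ := by rw [← add_mul]; norm_num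

/-- The negative powers `2 ^ (-(1 + δ) * level n)` are summable over the integers. -/
lemma tsum_two_rpow_level_le (δ : ℝ) :
    ∑' n : ℤ, (2 : ℝ≥0∞) ^ (-(1 + δ) * (level n : ℝ)) ≤ 3 * geomConst δ := by
  -- Modulo 1 the residue class is all of ℤ.
  simpa [Int.modEq_one] using tsum_modEq_le (δ := δ) (k := 0) (N := 1) le_rfl 0

/-! ### Sums over multi-indices -/

lemma tsum_prod_pi {ι : Type*} {d : ℕ} (f : Fin d → ι → ℝ≥0∞) :
    ∑' k : Fin d → ι, ∏ j, f j (k j) = ∏ j, ∑' i, f j i := by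
  induction d with
  | zero => simp
  | succ d ih =>
    rw [← (Fin.insertNthEquiv (fun _ => ι) 0).tsum_eq, ENNReal.tsum_prod', Fin.prod_univ_succ, ← ih]
    simp_rw [Fin.prod_univ_succ]
    simp [ENNReal.tsum_mul_left, ENNReal.tsum_mul_right, Fin.insertNthEquiv]

lemma two_rpow_sum {ι : Type*} (s : Finset ι) (x : ι → ℝ) :
    (2 : ℝ≥0∞) ^ (∑ j ∈ s, x j) = ∏ j ∈ s, (2 : ℝ≥0∞) ^ x j := by
  classical
  induction s using Finset.induction_on with
  | empty => simp
  | insert a s ha ih => rw [Finset.sum_insert ha, Finset.prod_insert ha, two_rpow_add, ih]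

/-- The levels of the components of a multi-frequency. -/
def levels {d : ℕ} (n : Fin d → ℤ) : Fin d → ℕ := fun j => level (n j)

lemma mem_dyadicBox {d : ℕ} {k : Fin d → ℕ} {m : Fin d → ℤ} : m ∈ dyadicBox k ↔ levels m = k := by
  simp [dyadicBox, mem_dyadicBlock, funext_iff, levels]

lemma le_normInf {d : ℕ} (k : Fin d → ℕ) (j : Fin d) : k j ≤ normInf k :=
  Finset.le_sup (f := k) (Finset.mem_univ j)

lemma normInf_le_norm1 {d : ℕ} (k : Fin d → ℕ) : normInf k ≤ norm1 k :=
  Finset.sup_le fun j _ => Finset.single_le_sum (fun _ _ => Nat.zero_le _) (Finset.mem_univ j)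

lemma normInf_mono {d : ℕ} {k l : Fin d → ℕ} (h : k ≤ l) : normInf k ≤ normInf l :=
  Finset.sup_mono_fun fun j _ => h j

lemma norm1_mono {d : ℕ} {k l : Fin d → ℕ} (h : k ≤ l) : norm1 k ≤ norm1 l :=
  Finset.sum_le_sum fun j _ => h j

/-- Passing from k to l raises the maximum by at most the total increase. Written without
subtraction; it serves the case β ≤ 0 of the Schur test. -/
lemma normInf_add_norm1_le {d : ℕ} {k l : Fin d → ℕ} (h : k ≤ l) :
    normInf l + norm1 k ≤ normInf k + norm1 l := by
  have h1 : ∑ j, (l j - k j) + norm1 k = norm1 l := by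
    rw [norm1, norm1, ← Finset.sum_add_distrib]
    exact Finset.sum_congr rfl fun j _ => Nat.sub_add_cancel (h j)
  have h2 : normInf l ≤ normInf k + ∑ j, (l j - k j) := by
    refine Finset.sup_le fun j _ => ?_
    have h3 := le_normInf k j
    have h4 : l j - k j ≤ ∑ j, (l j - k j) :=
      Finset.single_le_sum (f := fun j => l j - k j) (fun _ _ => Nat.zero_le _) (Finset.mem_univ j)
    omega
  omega

lemma norm1_eq_add_succAbove {d : ℕ} (k : Fin (d + 1) → ℕ) (i : Fin (d + 1)) :
    norm1 k = k i + norm1 (fun j => k (i.succAbove j)) :=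
  Fin.sum_univ_succAbove k i

lemma two_rpow_norm1 {d : ℕ} (c : ℝ) (k : Fin d → ℕ) :
    (2 : ℝ≥0∞) ^ (c * (norm1 k : ℝ)) = ∏ j, (2 : ℝ≥0∞) ^ (c * (k j : ℝ)) := by
  rw [← two_rpow_sum, norm1, Nat.cast_sum, Finset.mul_sum]

/-! ### The index set -/

/-- As |k|_∞ ≤ |k|_1 and γ-β-ε > 0, the defining form is at least (α-(γ-β))|k|_1, with a positive
factor. -/
lemma indexSet_finite (d : ℕ) {α β γ ε : ℝ} (ξ : ℝ) (hεγ : ε < γ - β) (hγα : γ - β < α) :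
    (indexSet d α β γ ε ξ).Finite := by
  obtain ⟨N, hN⟩ := exists_nat_ge (ξ / (α - (γ - β)))
  refine (Set.finite_Iic (fun _ : Fin d => N)).subset fun k hk j => ?_
  have h1 : (normInf k : ℝ) ≤ norm1 k := by exact_mod_cast normInf_le_norm1 k
  have h2 : (k j : ℝ) ≤ norm1 k := by
    exact_mod_cast (le_normInf k j).trans (normInf_le_norm1 k)
  have h3 : (α - ε) * (norm1 k : ℝ) - (γ - β - ε) * (normInf k : ℝ) ≤ ξ := hk
  have h4 : (norm1 k : ℝ) ≤ ξ / (α - (γ - β)) := by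
    rw [le_div_iff₀ (by linarith)]
    nlinarith [mul_le_mul_of_nonneg_left h1 (by linarith : 0 ≤ γ - β - ε)]
  exact_mod_cast h2.trans (h4.trans hN)

/-- The first term past the threshold is below 2^(-2ξ), and the rest decay geometrically from it.
The bound does not depend on the shift c, which later carries the other coordinates. -/
lemma tsum_tail_two_rpow_le {s : ℝ} (hs : 0 < s) (c ξ : ℝ) :
    ∑' n : ℕ, (if ξ < s * n + c then (2 : ℝ≥0∞) ^ (-2 * (s * n + c)) else 0) ≤
      2 ^ (-2 * ξ) * geomConst (2 * s) := by
  have hex : ∃ n : ℕ, ξ < s * n + c := by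
    obtain ⟨n, hn⟩ := exists_nat_gt ((ξ - c) / s)
    rw [div_lt_iff₀ hs] at hn
    exact ⟨n, by linarith⟩
  classical
  set n₀ := Nat.find hex with hn₀
  have h0 : ξ < s * n₀ + c := Nat.find_spec hex
  calc _ ≤ ∑' n : ℕ, ∑' p : ℕ,
        (if n = n₀ + p then (2 : ℝ≥0∞) ^ (-2 * ξ) * 2 ^ (-(2 * s) * p) else 0) := by
        refine ENNReal.tsum_le_tsum fun n => ?_
        split_ifs with h1
        · obtain ⟨p, rfl⟩ := Nat.exists_eq_add_of_le (Nat.find_min' hex h1)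
          refine le_trans ?_ (ENNReal.le_tsum p)
          rw [if_pos rfl, ← two_rpow_add]
          refine two_rpow_mono ?_
          push_cast
          rw [← hn₀]
          linarith
        · exact zero_le
    _ = 2 ^ (-2 * ξ) * geomConst (2 * s) := by
        rw [ENNReal.tsum_comm]
        simp_rw [tsum_ite_eq]
        rw [ENNReal.tsum_mul_left, tsum_two_rpow]

/-- Let k_i be maximal, l the other coordinates, s = α-(γ-β). Being outside the set means s k_i +
(α-ε)|l|_1 > ξ, and the summand is 2^(-2(s k_i + (α-ε)|l|_1)) · 2^(-2ε|l|_1). Summing over k_i gives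
2^(-2ξ) uniformly in l; the last factor makes the sum over l finite. -/
lemma tsum_compl_indexSet_le (d : ℕ) {α β γ ε ξ : ℝ} (hγα : γ - β < α) (hξ : 0 < ξ) :
    ∑' k : ↥(indexSet d α β γ ε ξ)ᶜ,
        (2 : ℝ≥0∞) ^ (2 * ((γ - β) * (normInf k.1 : ℝ) - α * (norm1 k.1 : ℝ))) ≤
      (d * geomConst (2 * (α - (γ - β))) * geomConst (2 * ε) ^ (d - 1)) * 2 ^ (-2 * ξ) := by
  rw [tsum_subtype (indexSet d α β γ ε ξ)ᶜ
    (fun k => (2 : ℝ≥0∞) ^ (2 * ((γ - β) * (normInf k : ℝ) - α * (norm1 k : ℝ))))]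
  cases d with
  | zero =>
    -- For d = 0 the only index lies in the set because ξ > 0, so the sum is empty.
    refine le_trans (le_of_eq ?_) zero_le
    rw [ENNReal.tsum_eq_zero]
    intro k
    refine Set.indicator_of_notMem (Set.notMem_compl_iff.2 ?_) _
    simp [indexSet, norm1, normInf, hξ.le]
  | succ d =>
    set s := α - (γ - β) with hs
    have hs0 : 0 < s := by linarith
    set G : Fin (d + 1) → ℕ → (Fin d → ℕ) → ℝ≥0∞ := fun i n l =>
      (if ξ < s * n + (α - ε) * norm1 l then (2 : ℝ≥0∞) ^ (-2 * (s * n + (α - ε) * norm1 l)) else 0)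
        * 2 ^ (-(2 * ε) * (norm1 l : ℝ)) with hG
    calc _ ≤ ∑' k : Fin (d + 1) → ℕ, ∑ i, G i (k i) (fun j => k (i.succAbove j)) := by
          refine ENNReal.tsum_le_tsum fun k => ?_
          by_cases hk : k ∈ indexSet (d + 1) α β γ ε ξ
          · rw [Set.indicator_of_notMem (Set.notMem_compl_iff.2 hk)]
            exact zero_le
          · rw [Set.indicator_of_mem (show k ∈ (indexSet (d + 1) α β γ ε ξ)ᶜ from hk)]
            obtain ⟨i, -, hi⟩ := Finset.exists_mem_eq_sup Finset.univ Finset.univ_nonempty k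
            refine le_trans ?_ (Finset.single_le_sum
              (f := fun i => G i (k i) (fun j => k (i.succAbove j)))
              (fun _ _ => zero_le) (Finset.mem_univ i))
            have hk' : ¬ (α - ε) * (norm1 k : ℝ) - (γ - β - ε) * (normInf k : ℝ) ≤ ξ := hk
            have hi' : normInf k = k i := hi
            rw [hi', norm1_eq_add_succAbove k i] at hk'
            rw [hi', norm1_eq_add_succAbove k i]
            push_cast at hk' ⊢
            rw [hG]
            beta_reduce
            rw [if_pos (by rw [hs]; linarith), ← two_rpow_add]
            refine two_rpow_mono (le_of_eq ?_)
            rw [hs]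
            ring
      _ = ∑ i, ∑' k : Fin (d + 1) → ℕ, G i (k i) (fun j => k (i.succAbove j)) :=
          Summable.tsum_finsetSum fun _ _ => ENNReal.summable
      _ ≤ ∑ i : Fin (d + 1), 2 ^ (-2 * ξ) * geomConst (2 * s) * geomConst (2 * ε) ^ d := by
          refine Finset.sum_le_sum fun i _ => ?_
          rw [← (Fin.insertNthEquiv (fun _ => ℕ) i).tsum_eq, ENNReal.tsum_prod', ENNReal.tsum_comm]
          simp only [Fin.insertNthEquiv, Equiv.coe_fn_mk, Fin.insertNth_apply_same,
            Fin.insertNth_apply_succAbove, hG]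
          simp_rw [ENNReal.tsum_mul_right]
          refine (ENNReal.tsum_le_tsum fun l => mul_le_mul_left
            (tsum_tail_two_rpow_le hs0 _ ξ) _).trans (le_of_eq ?_)
          rw [ENNReal.tsum_mul_left]
          simp_rw [two_rpow_norm1]
          rw [tsum_prod_pi (fun _ (i : ℕ) => (2 : ℝ≥0∞) ^ (-(2 * ε) * (i : ℝ)))]
          simp_rw [tsum_two_rpow]
          simp
      _ = _ := by
          rw [Finset.sum_const, Finset.card_univ, Fintype.card_fin, nsmul_eq_mul,
            Nat.add_sub_cancel]
          ring

/-! ### Cauchy-Schwarz and the Schur test -/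

lemma sq_tsum_mul_le {ι : Type*} (x y : ι → ℝ≥0∞) :
    (∑' i, x i * y i) ^ 2 ≤ (∑' i, x i ^ 2) * ∑' i, y i ^ 2 := by
  have h : ∑' i, x i * y i ≤ ((∑' i, x i ^ 2) * ∑' i, y i ^ 2) ^ (1 / 2 : ℝ) := by
    rw [ENNReal.tsum_eq_iSup_sum]
    refine iSup_le fun s => ?_
    refine (ENNReal.inner_le_Lp_mul_Lq s x y Real.HolderConjugate.two_two).trans ?_
    rw [ENNReal.mul_rpow_of_nonneg _ _ (by norm_num)]
    simp only [ENNReal.rpow_ofNat]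
    gcongr <;> exact ENNReal.sum_le_tsum s
  calc _ ≤ (((∑' i, x i ^ 2) * ∑' i, y i ^ 2) ^ (1 / 2 : ℝ)) ^ 2 := by gcongr
    _ = _ := by rw [← ENNReal.rpow_mul_natCast]; norm_num

/-- Cauchy-Schwarz after the splitting K c = √(Kσ) · √(Kσ⁻¹c²), with σ free to be chosen. -/
lemma sq_tsum_le_weighted {ι : Type*} (K c σ : ι → ℝ≥0∞) (h0 : ∀ i, σ i ≠ 0) (h1 : ∀ i, σ i ≠ ∞) :
    (∑' i, K i * c i) ^ 2 ≤ (∑' i, K i * σ i) * ∑' i, K i * (σ i)⁻¹ * c i ^ 2 := by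
  have h := sq_tsum_mul_le (fun i => (K i * σ i) ^ (1 / 2 : ℝ))
    (fun i => (K i * (σ i)⁻¹ * c i ^ 2) ^ (1 / 2 : ℝ))
  have h2 : ∀ x : ℝ≥0∞, (x ^ (1 / 2 : ℝ)) ^ 2 = x := fun x => by
    rw [← ENNReal.rpow_mul_natCast]; norm_num
  have h3 : ∀ i, (K i * σ i) ^ (1 / 2 : ℝ) * (K i * (σ i)⁻¹ * c i ^ 2) ^ (1 / 2 : ℝ) =
      K i * c i := by
    intro i
    rw [← ENNReal.mul_rpow_of_nonneg _ _ (by norm_num)]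
    have h4 : K i * σ i * (K i * (σ i)⁻¹ * c i ^ 2) = (K i * c i) ^ 2 := by
      calc _ = (σ i * (σ i)⁻¹) * (K i * c i) ^ 2 := by ring
        _ = _ := by rw [ENNReal.mul_inv_cancel (h0 i) (h1 i), one_mul]
    rw [h4, ← ENNReal.rpow_natCast, ← ENNReal.rpow_mul]
    norm_num
  simp only [h2, h3] at h
  exact h

/-! ### Row and column sums of the aliasing matrices. -/

/-- The modulus of the aliasing matrix of the tensor product operator `q k`. -/
def absCoef {d : ℕ} (k : Fin d → ℕ) (n m : Fin d → ℤ) : ℝ≥0∞ :=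
  ∏ j, ‖etaCoef (k j) (n j) (m j)‖ₑ

lemma le_levels_of_absCoef_ne_zero {d : ℕ} {k : Fin d → ℕ} {n m : Fin d → ℤ}
    (h : absCoef k n m ≠ 0) : k ≤ levels n := by
  intro j
  by_contra! hj
  exact h (Finset.prod_eq_zero (Finset.mem_univ j) (by rw [etaCoef_eq_zero _ hj, enorm_zero]))

lemma normInf_levels_le_of_absCoef_ne_zero {d : ℕ} {k : Fin d → ℕ} {n m : Fin d → ℤ}
    (h : absCoef k n m ≠ 0) : normInf (levels m) ≤ normInf k + 1 := by
  refine Finset.sup_le fun j _ => ?_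
  have h1 : etaCoef (k j) (n j) (m j) ≠ 0 := fun h0 =>
    h (Finset.prod_eq_zero (Finset.mem_univ j) (by rw [h0, enorm_zero]))
  exact (level_le_of_etaCoef_ne_zero h1).trans (Nat.succ_le_succ (le_normInf k j))

lemma tsum_absCoef_le {d : ℕ} (k : Fin d → ℕ) (n : Fin d → ℤ) : ∑' m, absCoef k n m ≤ 2 ^ d := by
  simp_rw [absCoef]
  rw [tsum_prod_pi (fun j m => ‖etaCoef (k j) (n j) m‖ₑ)]
  refine (Finset.prod_le_prod' fun j _ => tsum_enorm_etaCoef_le (k j) (n j)).trans ?_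
  simp

open scoped Classical in
-- On the support of the matrix |m|_∞ ≤ |k|_∞ + 1 in levels, so the weight leaves the sum at the
-- price of 2^(2γ); without k ≤ `levels n` the whole row vanishes.
lemma tsum_weight_absCoef_le {d : ℕ} {γ : ℝ} (hγ : 0 ≤ γ) (k : Fin d → ℕ) (n : Fin d → ℤ) :
    ∑' m, (2 : ℝ≥0∞) ^ (2 * γ * (normInf (levels m) : ℝ)) * absCoef k n m ≤
      if k ≤ levels n then 2 ^ (2 * γ * (normInf k : ℝ)) * (2 ^ (2 * γ) * 2 ^ d) else 0 := by
  split_ifs with h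
  · rw [← mul_assoc, ← two_rpow_add]
    refine le_trans (ENNReal.tsum_le_tsum fun m => ?_)
      ((ENNReal.tsum_mul_left).trans_le (mul_le_mul_right (tsum_absCoef_le k n) _))
    by_cases h0 : absCoef k n m = 0
    · simp [h0]
    · refine mul_le_mul_left (two_rpow_mono ?_) _
      have h1 : (normInf (levels m) : ℝ) ≤ normInf k + 1 := by
        exact_mod_cast normInf_levels_le_of_absCoef_ne_zero h0
      nlinarith
  · refine le_of_eq (ENNReal.tsum_eq_zero.2 fun m => ?_)
    rw [not_imp_comm.1 le_levels_of_absCoef_ne_zero h, mul_zero]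

lemma tsum_level_absCoef_le {d : ℕ} (δ : ℝ) (k : Fin d → ℕ) (m : Fin d → ℤ) :
    ∑' n, (2 : ℝ≥0∞) ^ (-(1 + δ) * ((norm1 (levels n) : ℝ) - norm1 k)) * absCoef k n m ≤
      (6 * geomConst δ) ^ d := by
  have h : ∀ n : Fin d → ℤ,
      (2 : ℝ≥0∞) ^ (-(1 + δ) * ((norm1 (levels n) : ℝ) - norm1 k)) * absCoef k n m =
      ∏ j, (2 : ℝ≥0∞) ^ (-(1 + δ) * ((level (n j) : ℝ) - k j)) *
        ‖etaCoef (k j) (n j) (m j)‖ₑ := by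
    intro n
    rw [Finset.prod_mul_distrib, ← two_rpow_sum, absCoef, ← Finset.mul_sum, norm1, norm1,
      Nat.cast_sum, Nat.cast_sum, Finset.sum_sub_distrib]
    rfl
  simp_rw [h]
  rw [tsum_prod_pi (fun j n => (2 : ℝ≥0∞) ^ (-(1 + δ) * ((level n : ℝ) - k j)) *
        ‖etaCoef (k j) n (m j)‖ₑ)]
  refine (Finset.prod_le_prod' fun j _ => tsum_level_etaCoef_le δ (k j) (m j)).trans ?_
  simp

open scoped Classical in
-- The indicator of k ≤ l and the power both factor over coordinates, leaving geometric series in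
-- l_j - k_j.
lemma tsum_le_two_rpow_sub_le {d : ℕ} (δ : ℝ) (l : Fin d → ℕ) :
    ∑' k : Fin d → ℕ, (if k ≤ l then (2 : ℝ≥0∞) ^ (-δ * ((norm1 l : ℝ) - norm1 k)) else 0) ≤
      geomConst δ ^ d := by
  have h1 : ∀ L : ℕ, ∑' k : ℕ, (if k ≤ L then (2 : ℝ≥0∞) ^ (-δ * ((L : ℝ) - k)) else 0) ≤
      geomConst δ := by
    intro L
    calc _ ≤ ∑' k : ℕ, ∑' r : ℕ, (if k = L - r then (2 : ℝ≥0∞) ^ (-δ * r) else 0) := by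
          refine ENNReal.tsum_le_tsum fun k => ?_
          split_ifs with hk
          · refine le_trans ?_ (ENNReal.le_tsum (L - k))
            rw [if_pos (by omega), Nat.cast_sub hk]
          · exact zero_le
      _ = geomConst δ := by
          rw [ENNReal.tsum_comm]
          simp_rw [tsum_ite_eq]
          exact tsum_two_rpow δ
  have h2 : ∀ k : Fin d → ℕ,
      (if k ≤ l then (2 : ℝ≥0∞) ^ (-δ * ((norm1 l : ℝ) - norm1 k)) else 0) =
      ∏ j, (if k j ≤ l j then (2 : ℝ≥0∞) ^ (-δ * ((l j : ℝ) - k j)) else 0) := by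
    intro k
    split_ifs with hk
    · rw [norm1, norm1, Nat.cast_sum, Nat.cast_sum, ← Finset.sum_sub_distrib, Finset.mul_sum,
        two_rpow_sum]
      exact Finset.prod_congr rfl fun j _ => (if_pos (hk j)).symm
    · rw [Pi.le_def, not_forall] at hk
      obtain ⟨j, hj⟩ := hk
      exact (Finset.prod_eq_zero (Finset.mem_univ j) (if_neg hj)).symm
  simp_rw [h2]
  rw [tsum_prod_pi (fun j k => (if k ≤ l j then (2 : ℝ≥0∞) ^ (-δ * ((l j : ℝ) - k)) else 0))]
  refine (Finset.prod_le_prod' fun j _ => h1 (l j)).trans ?_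
  simp

open scoped Classical in
/-- Schur test for the sum of the aliasing matrices outside the index set. -/
theorem tsum_sq_compl_indexSet_le (d : ℕ) {α β γ ε : ℝ} (hγ : 0 ≤ γ)
    (hmin : 1 / 2 < min α (α + β)) (hε : 0 < ε) (hγα : γ - β < α) :
    ∃ C : ℝ≥0∞, C ≠ ∞ ∧ ∀ (c : (Fin d → ℤ) → ℝ≥0∞) (ξ : ℝ), 0 < ξ →
      ∑' m, (2 : ℝ≥0∞) ^ (2 * γ * (normInf (levels m) : ℝ)) *
        (∑' n, c n * ∑' k : ↥(indexSet d α β γ ε ξ)ᶜ, absCoef k.1 n m) ^ 2 ≤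
      C * 2 ^ (-2 * ξ) * ∑' n, (2 : ℝ≥0∞) ^
        (2 * (α * (norm1 (levels n) : ℝ) + β * (normInf (levels n) : ℝ))) * c n ^ 2 := by
  obtain ⟨hm1, hm2⟩ := lt_min_iff.1 hmin
  -- The surplus 2δ over the critical exponent is halved: one δ makes the sum over n converge, the
  -- other the sum over k.
  set δ : ℝ := min α (α + β) - 1 / 2 with hδ
  have hδ0 : 0 < δ := by linarith
  have hδ1 : 1 + 2 * δ ≤ 2 * α := by linarith [min_le_left α (α + β)]
  have hδ2 : 1 + 2 * δ ≤ 2 * (α + β) := by linarith [min_le_right α (α + β)]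
  set C₁ : ℝ≥0∞ := d * geomConst (2 * (α - (γ - β))) * geomConst (2 * ε) ^ (d - 1) with hC₁
  have hC₁t : C₁ ≠ ∞ := by
    refine ENNReal.mul_ne_top (ENNReal.mul_ne_top (ENNReal.natCast_ne_top d) ?_) ?_
    · exact geomConst_ne_top (by linarith)
    · exact ENNReal.pow_ne_top (geomConst_ne_top (by linarith))
  -- The Schur weight is 2^(u+v): u gives the tail sum over k outside the index set, v the weight
  -- for the sum over n.
  set u : (Fin d → ℕ) → ℝ := fun k => 2 * ((γ - β) * (normInf k : ℝ) - α * (norm1 k : ℝ)) with hu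
  set v : (Fin d → ℕ) → (Fin d → ℤ) → ℝ := fun k n =>
    -(1 + δ) * ((norm1 (levels n) : ℝ) - norm1 k) with hv
  set A : ℝ≥0∞ := (6 * geomConst δ) ^ d with hA
  set B : ℝ≥0∞ := 2 ^ (2 * γ) * 2 ^ d with hB
  refine ⟨A * C₁ * (B * geomConst δ ^ d), ?_, fun c ξ hξ => ?_⟩
  · refine ENNReal.mul_ne_top (ENNReal.mul_ne_top ?_ hC₁t) (ENNReal.mul_ne_top ?_ ?_)
    · exact ENNReal.pow_ne_top (ENNReal.mul_ne_top (by norm_num) (geomConst_ne_top hδ0))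
    · exact ENNReal.mul_ne_top (two_rpow_ne_top _) (by norm_num)
    · exact ENNReal.pow_ne_top (geomConst_ne_top hδ0)
  set S := (indexSet d α β γ ε ξ)ᶜ with hS
  have hcs : ∀ m : Fin d → ℤ, (∑' n, c n * ∑' k : S, absCoef k.1 n m) ^ 2 ≤
      (A * (C₁ * 2 ^ (-2 * ξ))) *
        ∑' p : (Fin d → ℤ) × S, absCoef p.2.1 p.1 m * (2 ^ (u p.2.1 + v p.2.1 p.1))⁻¹ * c p.1 ^ 2 := by
    intro m
    have h1 : ∑' n, c n * ∑' k : S, absCoef k.1 n m =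
        ∑' p : (Fin d → ℤ) × S, absCoef p.2.1 p.1 m * c p.1 := by
      rw [ENNReal.tsum_prod']
      simp_rw [← ENNReal.tsum_mul_left, mul_comm]
    rw [h1]
    refine (sq_tsum_le_weighted _ _ (fun p : (Fin d → ℤ) × S => 2 ^ (u p.2.1 + v p.2.1 p.1))
      (fun _ => two_rpow_ne_zero _) (fun _ => two_rpow_ne_top _)).trans ?_
    refine mul_le_mul_left ?_ _
    rw [ENNReal.tsum_prod', ENNReal.tsum_comm]
    calc _ = ∑' k : S, 2 ^ (u k.1) * ∑' n, 2 ^ (v k.1 n) * absCoef k.1 n m := by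
          refine tsum_congr fun k => ?_
          rw [← ENNReal.tsum_mul_left]
          refine tsum_congr fun n => ?_
          rw [two_rpow_add]
          ring
      _ ≤ ∑' k : S, 2 ^ (u k.1) * A :=
          ENNReal.tsum_le_tsum fun k => mul_le_mul_right (tsum_level_absCoef_le δ k.1 m) _
      _ ≤ A * (C₁ * 2 ^ (-2 * ξ)) := by
          rw [ENNReal.tsum_mul_right, mul_comm]
          exact mul_le_mul_right (tsum_compl_indexSet_le d hγα hξ) _
  have hexp : ∀ (k : Fin d → ℕ) (n : Fin d → ℤ), k ≤ levels n →
      -(u k + v k n) + 2 * γ * (normInf k : ℝ) ≤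
        2 * (α * (norm1 (levels n) : ℝ) + β * (normInf (levels n) : ℝ)) +
          -δ * ((norm1 (levels n) : ℝ) - norm1 k) := by
    intro k n h
    have h1 : (normInf (levels n) : ℝ) + norm1 k ≤ normInf k + norm1 (levels n) := by
      exact_mod_cast normInf_add_norm1_le h
    have h2 : (normInf k : ℝ) ≤ normInf (levels n) := by exact_mod_cast normInf_mono h
    have h3 : (norm1 k : ℝ) ≤ norm1 (levels n) := by exact_mod_cast norm1_mono h
    rw [hu, hv]
    beta_reduce
    -- After cancellation the claim is (1+2δ)D ≤ 2αD + 2β(|n|_∞-|k|_∞) with D = |n|_1-|k|_1. For β ≥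
    -- 0 the last term is nonnegative; for β ≤ 0 it is at least 2βD by `h1`.
    rcases le_total 0 β with hβ | hβ
    · nlinarith [mul_nonneg hβ (sub_nonneg.2 h2),
        mul_nonneg (sub_nonneg.2 hδ1) (sub_nonneg.2 h3)]
    · nlinarith [mul_nonneg (neg_nonneg.2 hβ) (sub_nonneg.2 h1),
        mul_nonneg (sub_nonneg.2 hδ2) (sub_nonneg.2 h3)]
  calc _ ≤ ∑' m, (2 : ℝ≥0∞) ^ (2 * γ * (normInf (levels m) : ℝ)) * ((A * (C₁ * 2 ^ (-2 * ξ))) *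
        ∑' p : (Fin d → ℤ) × S,
          absCoef p.2.1 p.1 m * (2 ^ (u p.2.1 + v p.2.1 p.1))⁻¹ * c p.1 ^ 2) :=
        ENNReal.tsum_le_tsum fun m => mul_le_mul_right (hcs m) _
    _ = (A * (C₁ * 2 ^ (-2 * ξ))) * ∑' p : (Fin d → ℤ) × S,
          c p.1 ^ 2 * ((2 ^ (u p.2.1 + v p.2.1 p.1))⁻¹ *
            ∑' m, (2 : ℝ≥0∞) ^ (2 * γ * (normInf (levels m) : ℝ)) * absCoef p.2.1 p.1 m) := by
        simp_rw [← ENNReal.tsum_mul_left]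
        rw [ENNReal.tsum_comm]
        refine tsum_congr fun p => tsum_congr fun m => ?_
        ring
    _ ≤ (A * (C₁ * 2 ^ (-2 * ξ))) * ∑' p : (Fin d → ℤ) × S,
          c p.1 ^ 2 * (2 ^ (2 * (α * (norm1 (levels p.1) : ℝ) + β * (normInf (levels p.1) : ℝ))) * B *
            (if p.2.1 ≤ levels p.1 then
              2 ^ (-δ * ((norm1 (levels p.1) : ℝ) - norm1 p.2.1)) else 0)) := by
        refine mul_le_mul_right (ENNReal.tsum_le_tsum fun p => mul_le_mul_right ?_ _) _
        refine (mul_le_mul_right (tsum_weight_absCoef_le hγ p.2.1 p.1) _).trans ?_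
        split_ifs with h
        · rw [← ENNReal.rpow_neg, ← mul_assoc, ← two_rpow_add, mul_right_comm _ B, ← two_rpow_add]
          exact mul_le_mul_left (two_rpow_mono (hexp _ _ h)) _
        · simp
    _ ≤ (A * (C₁ * 2 ^ (-2 * ξ))) * ∑' n,
          c n ^ 2 * (2 ^ (2 * (α * (norm1 (levels n) : ℝ) + β * (normInf (levels n) : ℝ))) * B *
            geomConst δ ^ d) := by
        refine mul_le_mul_right ?_ _
        rw [ENNReal.tsum_prod']
        simp_rw [ENNReal.tsum_mul_left]
        gcongr with n
        exact (ENNReal.tsum_comp_le_tsum_of_injective Subtype.val_injective _).trans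
          (tsum_le_two_rpow_sub_le δ (levels n))
    _ = _ := by
        simp_rw [← ENNReal.tsum_mul_left]
        refine tsum_congr fun n => ?_
        ring

/-! ### Exponentials on the torus -/

lemma continuous_expChar {d : ℕ} (k : Fin d → ℤ) : Continuous (expChar k) := by
  unfold expChar
  fun_prop

lemma norm_fourier_apply (n : ℤ) (t : Circ) : ‖fourier n t‖ = 1 := by
  rw [fourier_apply, Circle.norm_coe]

lemma norm_expChar {d : ℕ} (k : Fin d → ℤ) (x : Torus d) : ‖expChar k x‖ = 1 := by
  rw [expChar, norm_prod]
  exact Finset.prod_eq_one fun j _ => norm_fourier_apply _ _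

lemma expChar_add {d : ℕ} (k l : Fin d → ℤ) (x : Torus d) :
    expChar (k + l) x = expChar k x * expChar l x := by
  simp [expChar, Finset.prod_mul_distrib]

lemma expChar_neg {d : ℕ} (k : Fin d → ℤ) (x : Torus d) :
    expChar (-k) x = (starRingEnd ℂ) (expChar k x) := by
  simp [expChar]

lemma expChar_zero {d : ℕ} (x : Torus d) : expChar 0 x = 1 := by
  simp [expChar]

lemma expChar_single {d : ℕ} (x : Torus d) (i : Fin d) :
    expChar (Pi.single i 1) x = fourier 1 (x i) := by
  rw [expChar, Finset.prod_eq_single i]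
  · rw [Pi.single_eq_same]
  · intro j _ hj
    rw [Pi.single_eq_of_ne hj, fourier_zero]
  · simp

/-- `expChar k` as a continuous map. -/
def expCharC {d : ℕ} (k : Fin d → ℤ) : C(Torus d, ℂ) := ⟨expChar k, continuous_expChar k⟩

/-- The star subalgebra generated by the exponentials. -/
def expSubalgebra (d : ℕ) : StarSubalgebra ℂ C(Torus d, ℂ) where
  toSubalgebra := Algebra.adjoin ℂ (Set.range expCharC)
  star_mem' := by
    change Algebra.adjoin ℂ (Set.range expCharC) ≤ star (Algebra.adjoin ℂ (Set.range expCharC))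
    refine Algebra.adjoin_le ?_
    rintro _ ⟨n, rfl⟩
    refine Algebra.subset_adjoin ⟨-n, ?_⟩
    ext1 x
    exact expChar_neg n x

lemma expSubalgebra_coe (d : ℕ) :
    Subalgebra.toSubmodule (expSubalgebra d).toSubalgebra =
      Submodule.span ℂ (Set.range (expCharC (d := d))) := by
  apply Algebra.adjoin_eq_span_of_subset
  refine .trans (fun x => Submonoid.closure_induction (fun _ => id) ⟨0, ?_⟩ ?_)
    Submodule.subset_span
  · ext x
    exact expChar_zero x
  · rintro _ _ _ _ ⟨m, rfl⟩ ⟨n, rfl⟩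
    refine ⟨m + n, ?_⟩
    ext x
    exact expChar_add m n x

/-- In a coordinate where the points differ, the exponential of frequency 1 is injective on the
circle. -/
lemma expSubalgebra_separatesPoints (d : ℕ) : (expSubalgebra d).SeparatesPoints := by
  intro x y hxy
  rw [Ne, funext_iff, not_forall] at hxy
  obtain ⟨i, hi⟩ := hxy
  refine ⟨_, ⟨expCharC (Pi.single i 1), Algebra.subset_adjoin ⟨Pi.single i 1, rfl⟩, rfl⟩, ?_⟩
  change expChar _ x ≠ expChar _ y
  rw [expChar_single, expChar_single, fourier_one, fourier_one]
  exact fun h => hi (AddCircle.injective_toCircle Real.two_pi_pos.ne' (Subtype.coe_injective h))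

lemma span_expCharC_closure_eq_top (d : ℕ) :
    (Submodule.span ℂ (Set.range (expCharC (d := d)))).topologicalClosure = ⊤ := by
  rw [← expSubalgebra_coe]
  exact congr_arg (Subalgebra.toSubmodule <| StarSubalgebra.toSubalgebra ·)
    (ContinuousMap.starSubalgebra_topologicalClosure_eq_top_of_separatesPoints _
      (expSubalgebra_separatesPoints d))

lemma integral_fourier (n : ℤ) : ∫ t : Circ, fourier n t = if n = 0 then 2 * (π : ℂ) else 0 := by
  have h := congrFun (fourierCoeff_fourier (T := 2 * π) n) 0
  rw [fourierCoeff, AddCircle.integral_haarAddCircle] at h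
  simp only [neg_zero, fourier_zero, one_smul, Pi.single_apply] at h
  have h2 : ((2 * π : ℝ) : ℂ) ≠ 0 := by exact_mod_cast Real.two_pi_pos.ne'
  rw [Complex.real_smul, Complex.ofReal_inv, inv_mul_eq_iff_eq_mul₀ h2] at h
  rw [h]
  simp [eq_comm]

/-- Fourier coefficients of a tensor product. -/
lemma fourierCoef_prod {d : ℕ} (φ : Fin d → Circ → ℂ) (m : Fin d → ℤ) :
    fourierCoef (fun x => ∏ j, φ j (x j)) m =
      ∏ j, (1 / (2 * (π : ℂ)) * ∫ t, φ j t * fourier (-m j) t) := by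
  rw [fourierCoef, Finset.prod_mul_distrib, ← MeasureTheory.integral_fintype_prod_volume_eq_prod]
  simp only [expChar, Finset.prod_mul_distrib, Finset.prod_const, Finset.card_univ,
    Fintype.card_fin, Pi.neg_apply, one_div, inv_pow]

lemma fourierCoef_fourier (n m : ℤ) :
    1 / (2 * (π : ℂ)) * ∫ t : Circ, fourier n t * fourier (-m) t = if n = m then 1 else 0 := by
  have h : ∀ t : Circ, fourier n t * fourier (-m) t = fourier (n - m) t := fun t => by
    rw [sub_eq_add_neg, fourier_add]
  have h2 : (π : ℂ) ≠ 0 := by exact_mod_cast Real.pi_ne_zero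
  simp_rw [h]
  rw [integral_fourier]
  by_cases hnm : n = m
  · simp only [hnm, sub_self, if_true]
    field_simp
  · simp [hnm, sub_eq_zero]

lemma fourierCoef_expChar {d : ℕ} (n m : Fin d → ℤ) :
    fourierCoef (expChar n) m = if n = m then 1 else 0 := by
  have h := fourierCoef_prod (fun j t => fourier (n j) t) m
  simp_rw [fourierCoef_fourier] at h
  refine h.trans ?_
  split_ifs with hnm
  · simp [hnm]
  · obtain ⟨j, hj⟩ := Function.ne_iff.1 hnm
    exact Finset.prod_eq_zero (Finset.mem_univ j) (if_neg hj)

lemma integrable_mul_expChar {d : ℕ} {f : Torus d → ℂ} (hf : Integrable f) (k : Fin d → ℤ) :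
    Integrable fun x => f x * expChar k x :=
  hf.mul_bdd (c := 1) (continuous_expChar k).aestronglyMeasurable
    (Filter.Eventually.of_forall fun x => (norm_expChar k x).le)

lemma fourierCoef_sub {d : ℕ} {f g : Torus d → ℂ} (hf : Integrable f) (hg : Integrable g)
    (m : Fin d → ℤ) : fourierCoef (f - g) m = fourierCoef f m - fourierCoef g m := by
  simp only [fourierCoef, Pi.sub_apply, sub_mul]
  rw [integral_sub (integrable_mul_expChar hf _) (integrable_mul_expChar hg _), mul_sub]

lemma fourierCoef_sum {d : ℕ} {ι : Type*} (s : Finset ι) {f : ι → Torus d → ℂ}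
    (hf : ∀ i ∈ s, Integrable (f i)) (m : Fin d → ℤ) :
    fourierCoef (∑ i ∈ s, f i) m = ∑ i ∈ s, fourierCoef (f i) m := by
  simp only [fourierCoef, Finset.sum_apply, Finset.sum_mul]
  rw [integral_finsetSum _ fun i hi => integrable_mul_expChar (hf i hi) _, Finset.mul_sum]

lemma fourierCoef_const_mul {d : ℕ} (c : ℂ) (f : Torus d → ℂ) (m : Fin d → ℤ) :
    fourierCoef (fun x => c * f x) m = c * fourierCoef f m := by
  simp only [fourierCoef, mul_assoc]
  rw [integral_const_mul]
  ring

lemma fourierCoef_congr {d : ℕ} {f g : Torus d → ℂ} (h : f =ᵐ[volume] g) :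
    fourierCoef f = fourierCoef g := by
  funext m
  rw [fourierCoef, fourierCoef]
  congr 1
  refine integral_congr_ae ?_
  filter_upwards [h] with x hx
  rw [hx]

lemma memLp_of_continuous {d : ℕ} {f : Torus d → ℂ} (hf : Continuous f) (p : ℝ≥0∞) :
    MemLp f p volume :=
  hf.memLp_of_hasCompactSupport (HasCompactSupport.of_compactSpace f)

lemma integrable_of_continuous {d : ℕ} {f : Torus d → ℂ} (hf : Continuous f) :
    Integrable f :=
  memLp_one_iff_integrable.1 (memLp_of_continuous hf 1)

/-- Fourier coefficients commute with dominated pointwise sums. -/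
lemma hasSum_fourierCoef {d : ℕ} {ι : Type*} [Countable ι] {F : ι → Torus d → ℂ}
    {G : Torus d → ℂ} (hF : ∀ i, Continuous (F i)) {b : ι → ℝ} (hb : Summable b)
    (hFb : ∀ i x, ‖F i x‖ ≤ b i) (hG : ∀ x, HasSum (fun i => F i x) (G x)) (m : Fin d → ℤ) :
    HasSum (fun i => fourierCoef (F i) m) (fourierCoef G m) := by
  refine HasSum.mul_left _ ?_
  refine hasSum_integral_of_dominated_convergence (fun i _ => b i)
    (fun i => ((hF i).mul (continuous_expChar _)).aestronglyMeasurable)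
    (fun i => Filter.Eventually.of_forall fun x => ?_)
    (Filter.Eventually.of_forall fun _ => hb) (integrable_const _)
    (Filter.Eventually.of_forall fun x => (hG x).mul_right _)
  rw [norm_mul, norm_expChar, mul_one]
  exact hFb i x

/-- An `L_2` function with vanishing Fourier coefficients vanishes almost everywhere. -/
theorem ae_eq_zero_of_fourierCoef {d : ℕ} {f : Torus d → ℂ} (hf : MemLp f 2 volume)
    (h : ∀ m, fourierCoef f m = 0) : f =ᵐ[volume] 0 := by
  have hdense : (Submodule.span ℂ (Set.range fun k : Fin d → ℤ =>
      ContinuousMap.toLp (E := ℂ) 2 (volume : Measure (Torus d)) ℂ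
        (expCharC k))).topologicalClosure = ⊤ := by
    simpa only [Submodule.map_span, ContinuousLinearMap.coe_coe, ← Set.range_comp,
      Function.comp_def] using
      (ContinuousMap.toLp_denseRange ℂ (volume : Measure (Torus d)) ℂ
        (p := 2) ENNReal.ofNat_ne_top).topologicalClosure_map_submodule
        (span_expCharC_closure_eq_top d)
  have hzero : hf.toLp f = 0 := by
    -- By density it suffices to be orthogonal to each exponential, and that inner product is a
    -- multiple of a Fourier coefficient.
    refine (Submodule.dense_iff_topologicalClosure_eq_top.2 hdense).eq_zero_of_inner_right ℂ
      fun v hv => ?_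
    induction hv using Submodule.span_induction with
    | mem v hv =>
      obtain ⟨k, rfl⟩ := hv
      rw [L2.inner_def]
      have h1 := h k
      have hpi : (2 * (π : ℂ)) ^ d ≠ 0 := by
        have h2 : (π : ℂ) ≠ 0 := by exact_mod_cast Real.pi_ne_zero
        exact pow_ne_zero _ (mul_ne_zero two_ne_zero h2)
      rw [fourierCoef, mul_eq_zero, or_iff_right (one_div_ne_zero hpi)] at h1
      rw [← h1]
      refine integral_congr_ae ?_
      filter_upwards [hf.coeFn_toLp, ContinuousMap.coeFn_toLp (p := 2) (𝕜 := ℂ)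
        (volume : Measure (Torus d)) (expCharC k)] with x h2 h3
      rw [h2, h3, expChar_neg]
      rfl
    | zero => exact inner_zero_left _
    | add u v _ _ hu hv => rw [inner_add_left, hu, hv, add_zero]
    | smul c u _ hu => rw [inner_smul_left, hu, mul_zero]
  exact ((hf.coeFn_toLp).symm.trans (by rw [hzero])).trans (Lp.coeFn_zero _ _ _)

/-! ### Norms in terms of Fourier coefficients -/

/-- Parseval's identity for trigonometric polynomials. -/
lemma eLpNorm_sum_expChar {d : ℕ} (s : Finset (Fin d → ℤ)) (a : (Fin d → ℤ) → ℂ) :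
    eLpNorm (fun x : Torus d => ∑ m ∈ s, a m * expChar m x) 2 volume ^ 2 =
      ENNReal.ofReal ((2 * π) ^ d) * ∑ m ∈ s, ‖a m‖ₑ ^ 2 := by
  set u : Torus d → ℂ := fun x => ∑ m ∈ s, a m * expChar m x with hu
  have hucont : Continuous u :=
    continuous_finsetSum _ fun m _ => continuous_const.mul (continuous_expChar m)
  have h1 : eLpNorm u 2 volume ^ 2 = ∫⁻ x, ‖u x‖ₑ ^ 2 := by
    have := eLpNorm_nnreal_pow_eq_lintegral (f := u) (μ := volume) (p := 2) two_ne_zero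
    simpa using this
  have h2 : ∫⁻ x, ‖u x‖ₑ ^ 2 = ENNReal.ofReal (∫ x, ‖u x‖ ^ 2) := by
    rw [ofReal_integral_eq_lintegral_ofReal]
    · refine lintegral_congr fun x => ?_
      rw [ENNReal.ofReal_pow (norm_nonneg _), ofReal_norm]
    · exact (memLp_of_continuous hucont 2).integrable_norm_pow two_ne_zero
    · exact Filter.Eventually.of_forall fun x => by positivity
  have h3 : ((∫ x, ‖u x‖ ^ 2 : ℝ) : ℂ) = (((2 * π) ^ d * ∑ m ∈ s, ‖a m‖ ^ 2 : ℝ) : ℂ) := by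
    rw [← integral_complex_ofReal]
    have h4 : ∀ x, ((‖u x‖ ^ 2 : ℝ) : ℂ) =
        ∑ m ∈ s, (starRingEnd ℂ) (a m) * (u x * expChar (-m) x) := by
      intro x
      have h5 : ((‖u x‖ ^ 2 : ℝ) : ℂ) = u x * (starRingEnd ℂ) (u x) := by
        rw [Complex.mul_conj, Complex.normSq_eq_norm_sq]
      rw [h5]
      -- Only the conjugated factor is expanded, so each term is a Fourier coefficient of u and no
      -- double sum arises.
      conv_lhs => enter [2, 2]; rw [hu]
      simp only [map_sum, map_mul, Finset.mul_sum, ← expChar_neg]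
      exact Finset.sum_congr rfl fun m _ => by ring
    simp_rw [h4]
    have hint : ∀ m, Integrable fun x => u x * expChar (-m) x := fun m =>
      integrable_mul_expChar (integrable_of_continuous hucont) _
    rw [integral_finsetSum _ fun m _ => (hint m).const_mul _]
    have hpi : (2 * (π : ℂ)) ^ d ≠ 0 := by
      have h2 : (π : ℂ) ≠ 0 := by exact_mod_cast Real.pi_ne_zero
      exact pow_ne_zero _ (mul_ne_zero two_ne_zero h2)
    have hcoef : ∀ m ∈ s, ∫ x, u x * expChar (-m) x = (2 * (π : ℂ)) ^ d * a m := by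
      intro m hm
      have h6 : fourierCoef u m = a m := by
        have h7 : u = ∑ n ∈ s, fun x => a n * expChar n x := by
          ext x; simp [hu]
        rw [h7, fourierCoef_sum (f := fun n x => a n * expChar n x) _
          fun n _ => integrable_of_continuous (continuous_const.mul (continuous_expChar n))]
        simp_rw [fourierCoef_const_mul, fourierCoef_expChar]
        simp [hm]
      rw [← h6, fourierCoef]
      field_simp
    push_cast
    rw [Finset.mul_sum]
    refine Finset.sum_congr rfl fun m hm => ?_
    rw [integral_const_mul, hcoef m hm, ← Complex.conj_mul']
    ring
  rw [h1, h2, Complex.ofReal_injective h3, ENNReal.ofReal_mul (by positivity),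
    ENNReal.ofReal_sum_of_nonneg fun _ _ => by positivity]
  congr 1
  refine Finset.sum_congr rfl fun m _ => ?_
  rw [ENNReal.ofReal_pow (norm_nonneg _), ofReal_norm]

/-- The boxes partition ℤ^d according to the level vector. -/
lemma tsum_dyadicBox {d : ℕ} (W : (Fin d → ℕ) → ℝ≥0∞) (F : (Fin d → ℤ) → ℝ≥0∞) :
    ∑' k, W k * ∑ m ∈ dyadicBox k, F m = ∑' m, W (levels m) * F m := by
  classical
  have h : ∀ k, W k * ∑ m ∈ dyadicBox k, F m =
      ∑' m, if k = levels m then W (levels m) * F m else 0 := by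
    intro k
    rw [tsum_eq_sum (s := dyadicBox k)
      (fun m hm => if_neg fun h => hm (mem_dyadicBox.2 h.symm)), Finset.mul_sum]
    refine Finset.sum_congr rfl fun m hm => ?_
    rw [mem_dyadicBox.1 hm, if_pos rfl]
  simp_rw [h]
  rw [ENNReal.tsum_comm]
  simp_rw [tsum_ite_eq]

lemma ofReal_two_rpow (x : ℝ) : ENNReal.ofReal ((2 : ℝ) ^ x) = 2 ^ x := by
  rw [← ENNReal.ofReal_rpow_of_pos two_pos, ENNReal.ofReal_ofNat]

lemma tsum_dyadicPart {d : ℕ} (w : (Fin d → ℕ) → ℝ) (f : Torus d → ℂ) :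
    ∑' k : Fin d → ℕ, ENNReal.ofReal ((2 : ℝ) ^ w k) * eLpNorm (dyadicPart k f) 2 volume ^ 2 =
      ENNReal.ofReal ((2 * π) ^ d) * ∑' m, 2 ^ w (levels m) * ‖fourierCoef f m‖ₑ ^ 2 := by
  rw [← tsum_dyadicBox (fun k => 2 ^ w k), ← ENNReal.tsum_mul_left]
  refine tsum_congr fun k => ?_
  have h : eLpNorm (dyadicPart k f) 2 volume ^ 2 = _ := eLpNorm_sum_expChar (dyadicBox k) _
  rw [h, ofReal_two_rpow]
  ring

lemma hybridNorm_eq {d : ℕ} (α β : ℝ) (f : Torus d → ℂ) :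
    hybridNorm α β f = (ENNReal.ofReal ((2 * π) ^ d) *
      ∑' m, 2 ^ (2 * (α * (norm1 (levels m) : ℝ) + β * (normInf (levels m) : ℝ))) *
        ‖fourierCoef f m‖ₑ ^ 2) ^ (1 / 2 : ℝ) := by
  rw [hybridNorm, tsum_dyadicPart (fun k => 2 * (α * (norm1 k : ℝ) + β * (normInf k : ℝ)))]

lemma sobolevNorm_eq {d : ℕ} (γ : ℝ) (f : Torus d → ℂ) :
    sobolevNorm γ f = (ENNReal.ofReal ((2 * π) ^ d) *
      ∑' m, 2 ^ (2 * γ * (normInf (levels m) : ℝ)) * ‖fourierCoef f m‖ₑ ^ 2) ^ (1 / 2 : ℝ) := by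
  rw [sobolevNorm, tsum_dyadicPart (fun k => 2 * (γ * (normInf k : ℝ)))]
  simp_rw [mul_assoc]

/-! ### Comparison of weights -/

lemma four_pow_level_div_le (n : ℤ) : (4 : ℝ) ^ level n / 4 ≤ 1 + (n : ℝ) ^ 2 := by
  rcases Nat.eq_zero_or_pos (level n) with h | h
  · rw [h, pow_zero]
    nlinarith [sq_nonneg (n : ℝ)]
  · obtain ⟨j, hj⟩ := Nat.exists_eq_succ_of_ne_zero h.ne'
    have h1 : 2 ^ j ≤ n.natAbs := Nat.lt_size.1 (show j < level n by omega)
    have h2 : (2 : ℝ) ^ j ≤ |(n : ℝ)| := by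
      rw [← Int.cast_abs, Int.abs_eq_natAbs]
      exact_mod_cast h1
    have h3 : ((2 : ℝ) ^ j) ^ 2 ≤ |(n : ℝ)| ^ 2 := by gcongr
    rw [sq_abs, ← pow_mul, mul_comm j 2, pow_mul] at h3
    norm_num at h3
    rw [hj, pow_succ]
    linarith

lemma one_add_sq_le_four_pow_level (n : ℤ) : 1 + (n : ℝ) ^ 2 ≤ 4 ^ level n := by
  have h1 : n.natAbs + 1 ≤ 2 ^ level n := natAbs_lt_two_pow_iff.2 le_rfl
  have h2 : |(n : ℝ)| + 1 ≤ 2 ^ level n := by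
    rw [← Int.cast_abs, Int.abs_eq_natAbs]
    exact_mod_cast h1
  have h3 : (|(n : ℝ)| + 1) ^ 2 ≤ (2 ^ level n) ^ 2 := by gcongr
  rw [← pow_mul, mul_comm _ 2, pow_mul] at h3
  norm_num at h3
  nlinarith [sq_abs (n : ℝ), abs_nonneg (n : ℝ)]

lemma four_pow_normInf_div_le {d : ℕ} (n : Fin d → ℤ) :
    (4 : ℝ) ^ normInf (levels n) / 4 ≤ 1 + ∑ j, (n j : ℝ) ^ 2 := by
  have h0 : 0 ≤ ∑ j, (n j : ℝ) ^ 2 := Finset.sum_nonneg fun j _ => sq_nonneg _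
  rcases isEmpty_or_nonempty (Fin d) with h | h
  · simp only [normInf, Finset.univ_eq_empty, Finset.sup_empty, Nat.bot_eq_zero, pow_zero,
      Finset.sum_empty]
    norm_num
  · obtain ⟨i, -, hi⟩ := Finset.exists_mem_eq_sup Finset.univ Finset.univ_nonempty (levels n)
    have h1 : normInf (levels n) = level (n i) := hi
    rw [h1]
    refine (four_pow_level_div_le (n i)).trans ?_
    have h2 := Finset.single_le_sum (f := fun j => (n j : ℝ) ^ 2)
      (fun j _ => sq_nonneg _) (Finset.mem_univ i)
    linarith

lemma one_add_sum_sq_le {d : ℕ} (n : Fin d → ℤ) :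
    1 + ∑ j, (n j : ℝ) ^ 2 ≤ (d + 1) * (4 : ℝ) ^ normInf (levels n) := by
  have h1 : ∀ j ∈ Finset.univ, (n j : ℝ) ^ 2 ≤ (4 : ℝ) ^ normInf (levels n) := by
    intro j _
    have h2 := one_add_sq_le_four_pow_level (n j)
    have h3 : (4 : ℝ) ^ level (n j) ≤ 4 ^ normInf (levels n) :=
      pow_le_pow_right₀ (by norm_num) (le_normInf (levels n) j)
    linarith
  have h2 := Finset.sum_le_sum h1
  rw [Finset.sum_const, Finset.card_univ, Fintype.card_fin, nsmul_eq_mul] at h2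
  have h3 : (1 : ℝ) ≤ 4 ^ normInf (levels n) := one_le_pow₀ (by norm_num)
  linarith

lemma four_pow_rpow (N : ℕ) (s : ℝ) : ((4 : ℝ) ^ N) ^ s = 2 ^ (2 * s * N) := by
  rw [← Real.rpow_natCast, ← Real.rpow_mul (by norm_num), show (4 : ℝ) = 2 ^ (2 : ℝ) by norm_num,
    ← Real.rpow_mul (by norm_num)]
  congr 1
  ring

lemma sobolev_weight_le {d : ℕ} {γ : ℝ} (hγ : 0 ≤ γ) (n : Fin d → ℤ) :
    (1 + ∑ j, (n j : ℝ) ^ 2) ^ γ ≤ (d + 1 : ℝ) ^ γ * 2 ^ (2 * γ * (normInf (levels n) : ℝ)) := by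
  have h0 : 0 ≤ ∑ j, (n j : ℝ) ^ 2 := Finset.sum_nonneg fun j _ => sq_nonneg _
  rw [← four_pow_rpow, ← Real.mul_rpow (by positivity) (by positivity)]
  exact Real.rpow_le_rpow (by positivity) (one_add_sum_sq_le n) hγ

/-- A negative power reverses order, so the sign of β decides whether the lower or the upper dyadic
bound on 1 + |n|² is used. -/
lemma exists_isotropic_weight_ge (d : ℕ) (β : ℝ) : ∃ c : ℝ, 0 < c ∧ ∀ n : Fin d → ℤ,
    c * 2 ^ (2 * β * (normInf (levels n) : ℝ)) ≤ (1 + ∑ j, (n j : ℝ) ^ 2) ^ β := by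
  have h0 : ∀ n : Fin d → ℤ, 0 ≤ ∑ j, (n j : ℝ) ^ 2 := fun n =>
    Finset.sum_nonneg fun j _ => sq_nonneg _
  rcases le_total 0 β with hβ | hβ
  · refine ⟨(1 / 4 : ℝ) ^ β, by positivity, fun n => ?_⟩
    rw [← four_pow_rpow, ← Real.mul_rpow (by positivity) (by positivity)]
    refine Real.rpow_le_rpow (by positivity) ?_ hβ
    linarith [four_pow_normInf_div_le n]
  · refine ⟨(d + 1 : ℝ) ^ β, by positivity, fun n => ?_⟩
    rw [← four_pow_rpow, ← Real.mul_rpow (by positivity) (by positivity)]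
    exact Real.rpow_le_rpow_of_nonpos (by linarith [h0 n]) (one_add_sum_sq_le n) hβ

lemma mixed_weight_ge {d : ℕ} {α : ℝ} (hα : 0 ≤ α) (n : Fin d → ℤ) :
    ((1 / 4 : ℝ) ^ α) ^ d * 2 ^ (2 * α * (norm1 (levels n) : ℝ)) ≤
      ∏ j, (1 + (n j : ℝ) ^ 2) ^ α := by
  have h1 : ((1 / 4 : ℝ) ^ α) ^ d * 2 ^ (2 * α * (norm1 (levels n) : ℝ)) =
      ∏ j, ((1 / 4 : ℝ) ^ α * 2 ^ (2 * α * (level (n j) : ℝ))) := by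
    rw [Finset.prod_mul_distrib, norm1, Nat.cast_sum, Finset.mul_sum,
      Real.rpow_sum_of_pos two_pos]
    simp [levels]
  rw [h1]
  refine Finset.prod_le_prod (fun j _ => by positivity) fun j _ => ?_
  rw [← four_pow_rpow, ← Real.mul_rpow (by positivity) (by positivity)]
  refine Real.rpow_le_rpow (by positivity) ?_ hα
  linarith [four_pow_level_div_le (n j)]

lemma MemHybrid.tsum_ne_top {d : ℕ} {α β : ℝ} (hα : 0 ≤ α) {f : Torus d → ℂ}
    (hf : MemHybrid α β f) :
    ∑' m, (2 : ℝ≥0∞) ^ (2 * (α * (norm1 (levels m) : ℝ) + β * (normInf (levels m) : ℝ))) *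
      ‖fourierCoef f m‖ₑ ^ 2 ≠ ∞ := by
  obtain ⟨c, hc, h⟩ := exists_isotropic_weight_ge d β
  set c' : ℝ := ((1 / 4 : ℝ) ^ α) ^ d * c with hc'
  have hc'0 : 0 < c' := by positivity
  have hs := (hf.2.mul_left c'⁻¹).tsum_ofReal_ne_top
  refine ne_top_of_le_ne_top hs (ENNReal.tsum_le_tsum fun m => ?_)
  rw [← ofReal_two_rpow, ← ofReal_norm, ← ENNReal.ofReal_pow (norm_nonneg _),
    ← ENNReal.ofReal_mul (by positivity)]
  refine ENNReal.ofReal_le_ofReal ?_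
  rw [le_inv_mul_iff₀ hc'0]
  have h1 : (2 : ℝ) ^ (2 * (α * (norm1 (levels m) : ℝ) + β * (normInf (levels m) : ℝ))) =
      2 ^ (2 * α * (norm1 (levels m) : ℝ)) * 2 ^ (2 * β * (normInf (levels m) : ℝ)) := by
    rw [← Real.rpow_add two_pos]
    congr 1
    ring
  have h2 := mul_le_mul (mixed_weight_ge hα m) (h m) (by positivity)
    (Finset.prod_nonneg fun j _ => by positivity)
  have h3 := mul_le_mul_of_nonneg_left h2 (sq_nonneg ‖fourierCoef f m‖)
  rw [h1, hc']
  calc _ = ‖fourierCoef f m‖ ^ 2 * ((1 / 4 : ℝ) ^ α) ^ d * 2 ^ (2 * α * (norm1 (levels m) : ℝ)) *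
        (c * 2 ^ (2 * β * (normInf (levels m) : ℝ))) := by ring
    _ ≤ _ := by linarith

lemma memSobolev_of_tsum_ne_top {d : ℕ} {γ : ℝ} (hγ : 0 ≤ γ) {f : Torus d → ℂ}
    (hf : MemLp f 2 volume)
    (h : ∑' m, (2 : ℝ≥0∞) ^ (2 * γ * (normInf (levels m) : ℝ)) * ‖fourierCoef f m‖ₑ ^ 2 ≠ ∞) :
    MemSobolev γ f := by
  refine ⟨hf, ?_⟩
  have h1 := (ENNReal.summable_toReal h).mul_left ((d + 1 : ℝ) ^ γ)
  refine Summable.of_nonneg_of_le (fun m => ?_) (fun m => ?_) h1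
  · have h0 : 0 ≤ ∑ j, (m j : ℝ) ^ 2 := Finset.sum_nonneg fun j _ => sq_nonneg _
    positivity
  · rw [← ofReal_two_rpow, ENNReal.toReal_mul, ENNReal.toReal_ofReal (by positivity),
      ENNReal.toReal_pow, toReal_enorm]
    have h2 := mul_le_mul_of_nonneg_left (sobolev_weight_le hγ m) (sq_nonneg ‖fourierCoef f m‖)
    linarith

/-- Cauchy-Schwarz against the inverse weight, which is summable: α|n|_1 + β|n|_∞ ≥ min(α, α+β)|n|_1
in levels, whatever the sign of β. -/
lemma MemHybrid.summable_norm {d : ℕ} {α β : ℝ} (hmin : 1 / 2 < min α (α + β)) {f : Torus d → ℂ}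
    (hf : MemHybrid α β f) : Summable fun m => ‖fourierCoef f m‖ := by
  obtain ⟨hm1, hm2⟩ := lt_min_iff.1 hmin
  have hS := hf.tsum_ne_top (by linarith)
  set δ : ℝ := 2 * min α (α + β) - 1 with hδ
  have hδ0 : 0 < δ := by linarith
  have hδ1 : 1 + δ ≤ 2 * α := by linarith [min_le_left α (α + β)]
  have hδ2 : 1 + δ ≤ 2 * (α + β) := by linarith [min_le_right α (α + β)]
  set σ : (Fin d → ℤ) → ℝ≥0∞ := fun m =>
    (2 : ℝ≥0∞) ^ (-(2 * (α * (norm1 (levels m) : ℝ) + β * (normInf (levels m) : ℝ)))) with hσ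
  have hcs := sq_tsum_le_weighted (fun _ => 1) (fun m => ‖fourierCoef f m‖ₑ) σ
    (fun m => two_rpow_ne_zero _) (fun m => two_rpow_ne_top _)
  simp only [one_mul, hσ, ENNReal.rpow_neg, inv_inv] at hcs
  have h1 : ∑' m : Fin d → ℤ, σ m ≤ (3 * geomConst δ) ^ d := by
    calc _ ≤ ∑' m : Fin d → ℤ, ∏ j, (2 : ℝ≥0∞) ^ (-(1 + δ) * (level (m j) : ℝ)) := by
          refine ENNReal.tsum_le_tsum fun m => ?_
          have h2 := two_rpow_norm1 (-(1 + δ)) (levels m)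
          refine le_trans (two_rpow_mono ?_) h2.le
          have h3 : (normInf (levels m) : ℝ) ≤ norm1 (levels m) := by
            exact_mod_cast normInf_le_norm1 _
          have h4 : (0 : ℝ) ≤ normInf (levels m) := Nat.cast_nonneg _
          rcases le_total 0 β with hβ | hβ
          · nlinarith [mul_nonneg hβ h4]
          · nlinarith [mul_nonneg (neg_nonneg.2 hβ) (sub_nonneg.2 h3)]
      _ ≤ (3 * geomConst δ) ^ d := by
          rw [tsum_prod_pi (fun _ n => (2 : ℝ≥0∞) ^ (-(1 + δ) * (level n : ℝ)))]
          refine (Finset.prod_le_prod' fun j _ => tsum_two_rpow_level_le δ).trans ?_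
          simp
  simp only [hσ, ENNReal.rpow_neg] at h1
  have h5 : (∑' m, ‖fourierCoef f m‖ₑ) ^ 2 ≠ ∞ := by
    refine ne_top_of_le_ne_top (ENNReal.mul_ne_top (ne_top_of_le_ne_top ?_ h1) hS) hcs
    exact ENNReal.pow_ne_top (ENNReal.mul_ne_top (by norm_num) (geomConst_ne_top hδ0))
  have h6 : ∑' m, ‖fourierCoef f m‖ₑ ≠ ∞ := fun h => h5 (by rw [h]; simp)
  simpa using ENNReal.summable_toReal h6

/-! ### The sampling operators on exponential series -/

/-- Only finitely many point values enter, so pointwise convergence is enough. -/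
lemma hasSum_interp {ι : Type*} (M : ℕ) {F : ι → Circ → ℂ} {G : Circ → ℂ}
    (h : ∀ t, HasSum (fun i => F i t) (G t)) (t : Circ) :
    HasSum (fun i => interp M (F i) t) (interp M G t) :=
  (hasSum_sum fun l _ => (h (node M l)).mul_right _).mul_left _

lemma hasSum_eta {ι : Type*} (k : ℕ) {F : ι → Circ → ℂ} {G : Circ → ℂ}
    (h : ∀ t, HasSum (fun i => F i t) (G t)) (t : Circ) :
    HasSum (fun i => eta k (F i) t) (eta k G t) := by
  cases k with
  | zero => exact hasSum_interp 1 h t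
  | succ k => exact (hasSum_interp _ h t).sub (hasSum_interp _ h t)

lemma hasSum_inVariable_prod {ι : Type*} {d : ℕ} (k : Fin d → ℕ) (l : List (Fin d))
    {F : ι → Torus d → ℂ} {G : Torus d → ℂ} (h : ∀ x, HasSum (fun i => F i x) (G x))
    (x : Torus d) :
    HasSum (fun i => (l.map fun j => inVariable j (eta (k j))).prod (F i) x)
      ((l.map fun j => inVariable j (eta (k j))).prod G x) := by
  induction l generalizing x with
  | nil => exact h x
  | cons a l ih =>
    rw [List.map_cons, List.prod_cons]
    exact hasSum_eta (k a) (fun t => ih (Function.update x a t)) (x a)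

lemma q_eq {d : ℕ} (k : Fin d → ℕ) :
    q k = ((List.finRange d).map fun j => inVariable j (eta (k j))).prod := by
  rw [q, List.ofFn_eq_map]

lemma hasSum_q {ι : Type*} {d : ℕ} (k : Fin d → ℕ) {F : ι → Torus d → ℂ} {G : Torus d → ℂ}
    (h : ∀ x, HasSum (fun i => F i x) (G x)) (x : Torus d) :
    HasSum (fun i => q k (F i) x) (q k G x) := by
  rw [q_eq]
  exact hasSum_inVariable_prod k _ h x

lemma Q_apply {d : ℕ} (Δ : Finset (Fin d → ℕ)) (f : Torus d → ℂ) : Q Δ f = ∑ k ∈ Δ, q k f := by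
  rw [Q, LinearMap.sum_apply]

lemma hasSum_Q {ι : Type*} {d : ℕ} (Δ : Finset (Fin d → ℕ)) {F : ι → Torus d → ℂ}
    {G : Torus d → ℂ} (h : ∀ x, HasSum (fun i => F i x) (G x)) (x : Torus d) :
    HasSum (fun i => Q Δ (F i) x) (Q Δ G x) := by
  simp_rw [Q_apply, Finset.sum_apply]
  exact hasSum_sum fun k _ => hasSum_q k h x

/-- With the other variables frozen the product is a scalar multiple of φ_i, and A is linear. -/
lemma inVariable_tensor {d : ℕ} (i : Fin d) (A : Module.End ℂ (Circ → ℂ)) (φ : Fin d → Circ → ℂ) :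
    inVariable i A (fun x => ∏ j, φ j (x j)) =
      fun x => ∏ j, Function.update φ i (A (φ i)) j (x j) := by
  ext x
  change A (fun t => ∏ j, φ j (Function.update x i t j)) (x i) = _
  have h1 : (fun t => ∏ j, φ j (Function.update x i t j)) =
      (∏ j ∈ Finset.univ.erase i, φ j (x j)) • φ i := by
    ext t
    rw [← Finset.mul_prod_erase _ _ (Finset.mem_univ i), Function.update_self, Pi.smul_apply,
      smul_eq_mul, mul_comm]
    congr 1
    refine Finset.prod_congr rfl fun j hj => ?_
    rw [Function.update_of_ne (Finset.ne_of_mem_erase hj)]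
  rw [h1, map_smul, ← Finset.mul_prod_erase _ _ (Finset.mem_univ i), Function.update_self,
    Pi.smul_apply, smul_eq_mul, mul_comm]
  congr 1
  refine Finset.prod_congr rfl fun j hj => ?_
  rw [Function.update_of_ne (Finset.ne_of_mem_erase hj)]

lemma inVariable_prod_tensor {d : ℕ} (A : Fin d → Module.End ℂ (Circ → ℂ))
    (φ : Fin d → Circ → ℂ) (l : List (Fin d)) (hl : l.Nodup) :
    (l.map fun j => inVariable j (A j)).prod (fun x => ∏ j, φ j (x j)) =
      fun x => ∏ j, (if j ∈ l then A j (φ j) else φ j) (x j) := by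
  induction l with
  | nil => simp
  | cons a l ih =>
    rw [List.nodup_cons] at hl
    rw [List.map_cons, List.prod_cons, Module.End.mul_apply, ih hl.2, inVariable_tensor]
    ext x
    refine Finset.prod_congr rfl fun j _ => ?_
    rcases eq_or_ne j a with rfl | hj
    · simp [hl.1]
    · simp [hj]

lemma q_expChar {d : ℕ} (k : Fin d → ℕ) (n : Fin d → ℤ) :
    q k (expChar n) = fun x => ∏ j, eta (k j) (fun t => fourier (n j) t) (x j) := by
  rw [q_eq]
  refine (inVariable_prod_tensor (fun j => eta (k j)) (fun j t => fourier (n j) t) _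
    (List.nodup_finRange d)).trans ?_
  simp

lemma eta_succ_fourier (k : ℕ) (n : ℤ) : eta (k + 1) (fun t => fourier n t) =
    fun t => fourier (aliasFreq (k + 1) n) t - fourier (aliasFreq k n) t := by
  rw [eta, LinearMap.sub_apply, interp_fourier, interp_fourier]
  rfl

lemma eta_zero_fourier (n : ℤ) :
    eta 0 (fun t => fourier n t) = fun t => fourier (aliasFreq 0 n) t := by
  rw [eta, interp_fourier]
  rfl

lemma continuous_eta_fourier (k : ℕ) (n : ℤ) : Continuous (eta k (fun t => fourier n t)) := by
  cases k with
  | zero => rw [eta_zero_fourier]; fun_prop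
  | succ k => rw [eta_succ_fourier]; fun_prop

lemma norm_eta_fourier_le (k : ℕ) (n : ℤ) (t : Circ) : ‖eta k (fun t => fourier n t) t‖ ≤ 2 := by
  cases k with
  | zero => rw [eta_zero_fourier, norm_fourier_apply]; norm_num
  | succ k =>
    rw [eta_succ_fourier]
    refine (norm_sub_le _ _).trans ?_
    rw [norm_fourier_apply, norm_fourier_apply]
    norm_num

lemma fourierCoef_eta_fourier (k : ℕ) (n m : ℤ) :
    1 / (2 * (π : ℂ)) * ∫ t : Circ, eta k (fun t => fourier n t) t * fourier (-m) t =
      etaCoef k n m := by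
  cases k with
  | zero =>
    rw [eta_zero_fourier, fourierCoef_fourier, etaCoef]
  | succ k =>
    rw [eta_succ_fourier, etaCoef, ← fourierCoef_fourier, ← fourierCoef_fourier, ← mul_sub,
      ← integral_sub]
    · simp_rw [sub_mul]
    all_goals
      exact Continuous.integrable_of_hasCompactSupport (by fun_prop)
        (HasCompactSupport.of_compactSpace _)

lemma continuous_q_expChar {d : ℕ} (k : Fin d → ℕ) (n : Fin d → ℤ) :
    Continuous (q k (expChar n)) := by
  rw [q_expChar]
  exact continuous_finsetProd _ fun j _ =>
    (continuous_eta_fourier (k j) (n j)).comp (continuous_apply j)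

lemma norm_q_expChar_le {d : ℕ} (k : Fin d → ℕ) (n : Fin d → ℤ) (x : Torus d) :
    ‖q k (expChar n) x‖ ≤ 2 ^ d := by
  rw [q_expChar, norm_prod]
  refine (Finset.prod_le_prod (fun _ _ => norm_nonneg _)
    fun j _ => norm_eta_fourier_le (k j) (n j) (x j)).trans ?_
  simp

lemma fourierCoef_q_expChar {d : ℕ} (k : Fin d → ℕ) (n m : Fin d → ℤ) :
    fourierCoef (q k (expChar n)) m = ∏ j, etaCoef (k j) (n j) (m j) := by
  rw [q_expChar, fourierCoef_prod (fun j => eta (k j) (fun t => fourier (n j) t))]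
  simp_rw [fourierCoef_eta_fourier]

lemma enorm_prod_etaCoef {d : ℕ} (k : Fin d → ℕ) (n m : Fin d → ℤ) :
    ‖∏ j, etaCoef (k j) (n j) (m j)‖ₑ = absCoef k n m := by
  simp_rw [absCoef, enorm_eq_nnnorm, nnnorm_prod]
  push_cast
  rfl

/-- The operators `q k` reproduce every exponential. -/
lemma sum_prod_etaCoef {d : ℕ} (n m : Fin d → ℤ) {s : Finset (Fin d → ℕ)}
    (hs : ∀ k, k ≤ levels n → k ∈ s) :
    ∑ k ∈ s, ∏ j, etaCoef (k j) (n j) (m j) = if n = m then 1 else 0 := by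
  have h1 : Fintype.piFinset (fun j => Finset.range (level (n j) + 1)) ⊆ s := by
    intro k hk
    refine hs k fun j => ?_
    have := Finset.mem_range.1 (Fintype.mem_piFinset.1 hk j)
    exact Nat.lt_succ_iff.1 this
  rw [← Finset.sum_subset h1]
  · rw [← Finset.prod_univ_sum (fun j => Finset.range (level (n j) + 1))
      (fun j k => etaCoef k (n j) (m j))]
    simp_rw [sum_etaCoef_level]
    split_ifs with h
    · simp [h]
    · obtain ⟨j, hj⟩ := Function.ne_iff.1 h
      exact Finset.prod_eq_zero (Finset.mem_univ j) (if_neg hj)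
  · intro k _ hk
    rw [Fintype.mem_piFinset, not_forall] at hk
    obtain ⟨j, hj⟩ := hk
    rw [Finset.mem_range, not_lt] at hj
    exact Finset.prod_eq_zero (Finset.mem_univ j) (etaCoef_eq_zero _ (by omega))

/-- Fourier coefficients of the sampling error of an exponential. -/
lemma enorm_fourierCoef_sub_Q_expChar_le {d : ℕ} (Δ : Finset (Fin d → ℕ)) (n m : Fin d → ℤ) :
    ‖fourierCoef (expChar n - Q Δ (expChar n)) m‖ₑ ≤
      ∑' k : ↥((Δ : Set (Fin d → ℕ))ᶜ), absCoef k.1 n m := by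
  classical
  have hint : ∀ k ∈ Δ, Integrable (q k (expChar n)) := fun k _ =>
    integrable_of_continuous (continuous_q_expChar k n)
  rw [Q_apply, fourierCoef_sub (integrable_of_continuous (continuous_expChar n))
    (integrable_finsetSum' _ hint), fourierCoef_sum _ hint, fourierCoef_expChar]
  simp_rw [fourierCoef_q_expChar]
  -- A finite set large enough to reproduce the exponential and to contain Δ; the error is then the
  -- sum over P \ Δ.
  set P : Finset (Fin d → ℕ) := Δ ∪ (Set.finite_Iic (levels n)).toFinset with hP
  have h1 := sum_prod_etaCoef n m (s := P) (fun k hk => by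
    rw [hP, Finset.mem_union, Set.Finite.mem_toFinset]; exact Or.inr hk)
  rw [← h1, ← Finset.sum_sdiff (show Δ ⊆ P from Finset.subset_union_left), add_sub_cancel_right]
  refine (enorm_sum_le _ _).trans ?_
  simp_rw [enorm_prod_etaCoef]
  rw [tsum_subtype ((Δ : Set (Fin d → ℕ))ᶜ) (fun k => absCoef k n m)]
  refine le_trans (Finset.sum_le_sum fun k hk => ?_) (ENNReal.sum_le_tsum (P \ Δ))
  rw [Set.indicator_of_mem]
  exact fun h => (Finset.mem_sdiff.1 hk).2 h

/-! ### The error estimate -/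

/-- The continuous representative of a function in the hybrid space. -/
lemma MemHybrid.exists_continuous {d : ℕ} {α β : ℝ} (hmin : 1 / 2 < min α (α + β))
    {f : Torus d → ℂ} (hf : MemHybrid α β f) :
    ∃ g : C(Torus d, ℂ), f =ᵐ[volume] g ∧
      ∀ x, HasSum (fun n => fourierCoef f n * expChar n x) (g x) := by
  have hsum := hf.summable_norm hmin
  have hcont : ∀ n, Continuous fun x => fourierCoef f n * expChar n x := fun n =>
    continuous_const.mul (continuous_expChar n)
  have hbd : ∀ n x, ‖fourierCoef f n * expChar n x‖ ≤ ‖fourierCoef f n‖ := fun n x => by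
    rw [norm_mul, norm_expChar, mul_one]
  set g : C(Torus d, ℂ) := ⟨fun x => ∑' n, fourierCoef f n * expChar n x,
    continuous_tsum hcont hsum hbd⟩ with hg
  have hgs : ∀ x, HasSum (fun n => fourierCoef f n * expChar n x) (g x) := fun x =>
    (Summable.of_norm_bounded hsum fun n => hbd n x).hasSum
  refine ⟨g, ?_, hgs⟩
  -- Dominated convergence gives g the coefficients of f; uniqueness in L_2 then identifies the two
  -- almost everywhere.
  have hcoef : ∀ m, fourierCoef g m = fourierCoef f m := by
    intro m
    have h1 := hasSum_fourierCoef hcont hsum hbd hgs m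
    simp_rw [fourierCoef_const_mul, fourierCoef_expChar] at h1
    refine h1.unique ?_
    convert hasSum_ite_eq m (fourierCoef f m) using 2 with n
    split_ifs with h
    · rw [h, mul_one]
    · rw [mul_zero]
  have hgL := memLp_of_continuous g.continuous 2
  have h0 := ae_eq_zero_of_fourierCoef (hf.1.sub hgL) fun m => by
    rw [fourierCoef_sub (hf.1.integrable one_le_two) (integrable_of_continuous g.continuous),
      hcoef, sub_self]
  filter_upwards [h0] with x hx
  exact sub_eq_zero.1 hx

/-- Coefficientwise bound for the sampling error of an absolutely convergent exponential series. -/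
lemma enorm_fourierCoef_sub_Q_le {d : ℕ} (Δ : Finset (Fin d → ℕ)) {c : (Fin d → ℤ) → ℂ}
    (hc : Summable fun n => ‖c n‖) {g : Torus d → ℂ}
    (hg : ∀ x, HasSum (fun n => c n * expChar n x) (g x)) :
    Continuous (g - Q Δ g) ∧ ∀ m, ‖fourierCoef (g - Q Δ g) m‖ₑ ≤
      ∑' n, ‖c n‖ₑ * ∑' k : ↥((Δ : Set (Fin d → ℕ))ᶜ), absCoef k.1 n m := by
  set R : (Fin d → ℤ) → Torus d → ℂ := fun n => expChar n - Q Δ (expChar n) with hR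
  have hRcont : ∀ n, Continuous (R n) := by
    intro n
    rw [hR]
    beta_reduce
    rw [Q_apply]
    refine (continuous_expChar n).sub ?_
    have := continuous_finsetSum Δ fun k _ => continuous_q_expChar k n
    convert this using 1
    ext x
    simp
  -- This crude bound depends on Δ but is used only for continuity and for interchanging sum and
  -- integral; it does not enter the final constant.
  have hRbd : ∀ n x, ‖c n * R n x‖ ≤ ‖c n‖ * (1 + Δ.card * 2 ^ d) := by
    intro n x
    rw [norm_mul]
    gcongr
    rw [hR]
    beta_reduce
    rw [Pi.sub_apply, Q_apply, Finset.sum_apply]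
    refine (norm_sub_le _ _).trans (add_le_add (norm_expChar n x).le ?_)
    refine (norm_sum_le_of_le _ fun k _ => norm_q_expChar_le k n x).trans ?_
    simp
  have hsum : ∀ x, HasSum (fun n => c n * R n x) ((g - Q Δ g) x) := by
    intro x
    have h1 := (hg x).sub (hasSum_Q Δ hg x)
    have h3 : ∀ n, c n * R n x =
        c n * expChar n x - Q Δ (fun x => c n * expChar n x) x := by
      intro n
      have h2 : (fun x => c n * expChar n x) = c n • expChar n := rfl
      rw [h2, map_smul, hR]
      simp [mul_sub]
    simp_rw [h3]
    exact h1
  have hcont : ∀ n, Continuous fun x => c n * R n x := fun n => continuous_const.mul (hRcont n)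
  have hb := hc.mul_right (1 + Δ.card * 2 ^ d : ℝ)
  refine ⟨?_, fun m => ?_⟩
  · have h1 := continuous_tsum hcont hb hRbd
    convert h1 using 1
    ext x
    exact (hsum x).tsum_eq.symm
  · have h1 := hasSum_fourierCoef hcont hb hRbd hsum m
    rw [← h1.tsum_eq]
    refine enorm_tsum_le_tsum_enorm.trans (ENNReal.tsum_le_tsum fun n => ?_)
    rw [fourierCoef_const_mul, enorm_mul]
    gcongr
    exact enorm_fourierCoef_sub_Q_expChar_le Δ n m

end SparseSampling

end

/-! ### The main theorem. -/

open SparseSampling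

theorem theorem4 (d : ℕ) (α β γ ε : ℝ) (hα : 0 < α) (hγ : 0 ≤ γ) (hβγ : β < γ)
    (hmin : 1 / 2 < min α (α + β)) (hε : 0 < ε) (hεγ : ε < γ - β) (hγα : γ - β < α) :
    ∃ C : ℝ, 0 < C ∧
      ∀ f : SparseSampling.Torus d → ℂ, SparseSampling.MemHybrid α β f →
        -- the continuous representative of `f`, which is the function that is sampled
        ∃ g : C(SparseSampling.Torus d, ℂ), f =ᵐ[volume] g ∧
          ∀ ξ : ℝ, 0 < ξ →
            ∃ hfin : (SparseSampling.indexSet d α β γ ε ξ).Finite,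
              SparseSampling.MemSobolev γ (f - SparseSampling.Q hfin.toFinset g) ∧
              SparseSampling.sobolevNorm γ (f - SparseSampling.Q hfin.toFinset g) ≤
                ENNReal.ofReal (C * (2 : ℝ) ^ (-ξ)) * SparseSampling.hybridNorm α β f := by
  obtain ⟨K, hK, hmain⟩ := tsum_sq_compl_indexSet_le d hγ hmin hε hγα
  set C : ℝ≥0∞ := K ^ (1 / 2 : ℝ) with hC
  have hCt : C ≠ ∞ := ENNReal.rpow_ne_top_of_nonneg (by norm_num) hK
  -- Adding 1 guarantees a positive constant.
  refine ⟨C.toReal + 1, by positivity, fun f hf => ?_⟩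
  obtain ⟨g, hfg, hg⟩ := hf.exists_continuous hmin
  refine ⟨g, hfg, fun ξ hξ => ?_⟩
  have hfin := indexSet_finite d ξ hεγ hγα
  obtain ⟨hcont, hcoef⟩ := enorm_fourierCoef_sub_Q_le hfin.toFinset (hf.summable_norm hmin) hg
  rw [hfin.coe_toFinset] at hcoef
  -- Both sides sample g, so changing f on a null set affects neither the Fourier coefficients nor
  -- membership in L_2.
  have hae : f - Q hfin.toFinset g =ᵐ[volume] ⇑g - Q hfin.toFinset g := by
    filter_upwards [hfg] with x hx
    rw [Pi.sub_apply, Pi.sub_apply, hx]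
  have hbound : ∑' m, (2 : ℝ≥0∞) ^ (2 * γ * (normInf (levels m) : ℝ)) *
      ‖fourierCoef (f - Q hfin.toFinset g) m‖ₑ ^ 2 ≤ K * 2 ^ (-2 * ξ) * ∑' n, (2 : ℝ≥0∞) ^
        (2 * (α * (norm1 (levels n) : ℝ) + β * (normInf (levels n) : ℝ))) *
          ‖fourierCoef f n‖ₑ ^ 2 := by
    rw [fourierCoef_congr hae]
    exact (ENNReal.tsum_le_tsum fun m => mul_le_mul_right (pow_le_pow_left' (hcoef m) 2) _).trans
      (hmain (fun n => ‖fourierCoef f n‖ₑ) ξ hξ)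
  refine ⟨hfin, ?_, ?_⟩
  · refine memSobolev_of_tsum_ne_top hγ ((memLp_of_continuous hcont 2).ae_eq hae.symm) ?_
    exact ne_top_of_le_ne_top (ENNReal.mul_ne_top (ENNReal.mul_ne_top hK (two_rpow_ne_top _))
      (hf.tsum_ne_top hα.le)) hbound
  · rw [sobolevNorm_eq, hybridNorm_eq]
    refine (ENNReal.rpow_le_rpow (mul_le_mul_right hbound _) (by norm_num)).trans ?_
    rw [mul_left_comm, ENNReal.mul_rpow_of_nonneg _ _ (by norm_num : (0 : ℝ) ≤ 1 / 2)]
    refine mul_le_mul_left ?_ _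
    rw [ENNReal.mul_rpow_of_nonneg _ _ (by norm_num : (0 : ℝ) ≤ 1 / 2), ← ENNReal.rpow_mul,
      ENNReal.ofReal_mul (by positivity), ofReal_two_rpow, ← hC,
      show -2 * ξ * (1 / 2) = -ξ by ring]
    refine mul_le_mul_left ?_ _
    rw [ENNReal.ofReal_add ENNReal.toReal_nonneg zero_le_one, ENNReal.ofReal_toReal hCt]
    exact le_self_add
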